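/- Let $1\le t\le \min\{m,n\}$, write $M_{m,n}^t=\{A\in M_{m,n}(\mathbb C)\mid \operatorname{rk}A<t\}$, and let $F:(\mathbb C^N,0)\to M_{m,n}(\mathbb C)$ be a holomorphic map germ such that $X=F^{-1}(M_{m,n}^t)$, with the structure given by the $t$-minors of $F$, contains $0$ and is there of codimension $(m-t+1)(n-t+1)$, i.e. $(X,0)$ is a determinantal singularity of type $(m,n,t)$. Assume $\dim (X,0)\ge m$. Assume that $\operatorname{Mat}(m,n;\mathbb C\{x\})/(J_F+J_{op})$ is of finite dimension $\tau$ over $\mathbb C$, where $J_F$ is the $\mathbb C\{x\}$-submodule generated by the partial derivatives of $F$ and $J_{op}=\langle AF+FB\rangle$, with $A$, $B$ ranging over the square matrices over $\mathbb C\{x\}$ of sizes $m$ and $n$; let $G_1,\dots,G_\tau$ represent a $\mathbb C$-basis, and let $F_s=F+\sum_i s_iG_i$, $s\in(\mathbb C^\tau,0)$, so that the spaces $X_s=F_s^{-1}(M_{m,n}^t)$ (defined by the $t$-minors of $F_s$) are the fibres of the $\mathcal G$-versal family of $X$. The Tjurina transform of $X_s$ is $Y_s=X_s\times_{M_{m,n}^t}W$,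 where $W\subset M_{m,n}\times \operatorname{Grass}(n-t+1,n)$ is the closure, with its reduced structure, of the set of pairs $(A,\ker A)$ with $\operatorname{rk}A=t-1$. Then there are neighbourhoods $U_0$ of $0\in\mathbb C^N$ and $S_0$ of $0\in\mathbb C^\tau$ such that for all $U\subseteq U_0$ and $S\subseteq S_0$ the discriminant $$D=\{s\in S\mid X_s \text{ is singular at some point of } U\}$$ decomposes as $D=D_A\cup D_B$, where (A) $D_A$ is the set of $s\in S$ over which the fibre has determinantal singularities, i.e. all $(t-1)$-minors of $F_s$ vanish at some point of $U$ (for $t=1$ the $0$-minor is $1$ and $D_A$ is empty); (B) $D_B$ is the set of $s\in S$ such that $X_s$ has a singular point $x\in U$ over which there is a singular point of $Y_s$. The same holds if in (B) only points $x$ with $\operatorname{rk}F_s(x)=t-1$ are admitted. More precisely, for $s\in S_0$ and $x\in U_0$: if $\operatorname{rk}F_s(x)<t-1$, then $X_s$ is singular at $x$; if $\operatorname{rk}F_s(x)=t-1$, then there is exactly one point of $Y_s$ over $x$, and $X_s$ is singular at $x$ if and only if $Y_s$ is singular at this point. -/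

import Mathlib

open Filter Topology

noncomputable section

namespace DetSing

/-! ### Convergent power series: germs of holomorphic functions -/

section Germs

variable {V : Type*} [NormedAddCommGroup V] [NormedSpace ℂ V]

/-- The subring of germs at `p` that have a representative holomorphic at `p`. -/
def holSubring (p : V) : Subring (Germ (𝓝 p) ℂ) where
  carrier := {g | ∃ f : V → ℂ, AnalyticAt ℂ f p ∧ (f : Germ (𝓝 p) ℂ) = g}
  mul_mem' := by
    rintro _ _ ⟨f, hf, rfl⟩ ⟨g, hg, rfl⟩
    exact ⟨f * g, hf.mul hg, rfl⟩
  add_mem' := by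
    rintro _ _ ⟨f, hf, rfl⟩ ⟨g, hg, rfl⟩
    exact ⟨f + g, hf.add hg, rfl⟩
  one_mem' := ⟨fun _ => 1, analyticAt_const, rfl⟩
  zero_mem' := ⟨fun _ => 0, analyticAt_const, rfl⟩
  neg_mem' := by
    rintro _ ⟨f, hf, rfl⟩
    exact ⟨-f, hf.neg, rfl⟩

/-- The local ring `𝒪_{V,p}` of germs at `p` of holomorphic functions on `V`; for `V = ℂ^N` and
`p = 0` this is the ring `ℂ{x₁, …, x_N}` of convergent power series. -/
abbrev HolGerm (p : V) : Type _ := holSubring p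

/-- The inclusion of the constants `ℂ → 𝒪_{V,p}`. -/
def constHom (p : V) : ℂ →+* HolGerm p where
  toFun c := ⟨((fun _ => c : V → ℂ) : Germ (𝓝 p) ℂ), fun _ => c, analyticAt_const, rfl⟩
  map_one' := rfl
  map_mul' _ _ := rfl
  map_zero' := rfl
  map_add' _ _ := rfl

instance (p : V) : Algebra ℂ (HolGerm p) := (constHom p).toAlgebra

open Classical in
/-- The germ at `p` of a function `f` that is holomorphic at `p` (and `0` for any other `f`). -/
def germAt (f : V → ℂ) (p : V) : HolGerm p :=
  if h : AnalyticAt ℂ f p then ⟨(f : Germ (𝓝 p) ℂ), f, h, rfl⟩ else 0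

end Germs

/-! ### Determinantal singularities -/

/-- The space `M_{m,n} ≅ ℂ^{mn}` of complex `m × n` matrices. -/
abbrev Mat (m n : ℕ) : Type := Fin m → Fin n → ℂ

/-- `ℂ^N` -/
abbrev Cn (N : ℕ) : Type := Fin N → ℂ

/-- The generic determinantal variety `M_{m,n}^t = {A | rk A < t}`. -/
def genericDet (m n t : ℕ) : Set (Mat m n) := {A | (Matrix.of A).rank < t}

section Spaces

variable {N m n : ℕ}

/-- The ideal of `𝒪_{ℂ^N,p}` generated by the `t`-minors of `F`; it defines the complex space
`F⁻¹(M_{m,n}^t)` near `p`. -/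
def minorIdeal (t : ℕ) (F : Cn N → Mat m n) (p : Cn N) : Ideal (HolGerm p) :=
  Ideal.span {g | ∃ (r : Fin t ↪o Fin m) (c : Fin t ↪o Fin n),
    g = germAt (fun x => ((Matrix.of (F x)).submatrix r c).det) p}

/-- The local ring at `p` of `F⁻¹(M_{m,n}^t)`. -/
abbrev detLocalRing (t : ℕ) (F : Cn N → Mat m n) (p : Cn N) : Type :=
  HolGerm p ⧸ minorIdeal t F p

/-- `p` is a singular point of `F⁻¹(M_{m,n}^t)`. -/
def IsSingularAt (t : ℕ) (F : Cn N → Mat m n) (p : Cn N) : Prop :=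
  F p ∈ genericDet m n t ∧ ¬ IsRegularLocalRing (detLocalRing t F p)

/-- The germ `F : (ℂ^N,0) → M_{m,n}` defines a determinantal singularity
`(X,0) = (F⁻¹(M_{m,n}^t),0)` of type `(m,n,t)`: the codimension of `X` at `0` is
`(m-t+1)(n-t+1)`. -/
structure IsDeterminantal (t : ℕ) (F : Cn N → Mat m n) : Prop where
  one_le : 1 ≤ t
  le_rows : t ≤ m
  le_cols : t ≤ n
  analytic : AnalyticAt ℂ F 0
  mem : F 0 ∈ genericDet m n t
  codim : ringKrullDim (detLocalRing t F 0) + (((m - t + 1) * (n - t + 1) : ℕ) : WithBot ℕ∞)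
    = (N : WithBot ℕ∞)

/-! ### `𝒢`-versal families -/

/-- The matrix over `ℂ{x}` given by the germ of `F` at `0`. -/
def matGerm (F : Cn N → Mat m n) : Matrix (Fin m) (Fin n) (HolGerm (0 : Cn N)) :=
  Matrix.of fun i j => germAt (fun x => F x i j) 0

/-- `J_F`: the submodule generated by the partial derivatives `∂F/∂x_k` of `F`. -/
def JF (F : Cn N → Mat m n) :
    Submodule (HolGerm (0 : Cn N)) (Matrix (Fin m) (Fin n) (HolGerm (0 : Cn N))) :=
  Submodule.span _ (Set.range fun k : Fin N =>
    matGerm fun x => fderiv ℂ F x (Pi.single k 1))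

/-- `J_op = ⟨A F + F B⟩`, with `A`, `B` square matrices over `ℂ{x}`. -/
def Jop (F : Cn N → Mat m n) :
    Submodule (HolGerm (0 : Cn N)) (Matrix (Fin m) (Fin n) (HolGerm (0 : Cn N))) :=
  Submodule.span _ {M | ∃ (A : Matrix (Fin m) (Fin m) (HolGerm (0 : Cn N)))
    (B : Matrix (Fin n) (Fin n) (HolGerm (0 : Cn N))), M = A * matGerm F + matGerm F * B}

/-- `Mat(m,n;ℂ{x}) / (J_F + J_op)`, whose complex dimension is the `𝒢`-Tjurina number. -/
abbrev T1G (F : Cn N → Mat m n) : Type :=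
  Matrix (Fin m) (Fin n) (HolGerm (0 : Cn N)) ⧸ (JF F ⊔ Jop F)

/-- The matrices `G₁, …, G_τ` are holomorphic at `0` and represent a `ℂ`-basis of
`Mat(m,n;ℂ{x}) / (J_F + J_op)` (so this space has finite dimension `τ`). -/
structure IsGVersalBasis (F : Cn N → Mat m n) {τ : ℕ} (G : Fin τ → Cn N → Mat m n) : Prop where
  analytic : ∀ i, AnalyticAt ℂ (G i) 0
  linearIndependent : LinearIndependent ℂ
    (fun i => (Submodule.Quotient.mk (matGerm (G i)) : T1G F))
  span_eq_top : Submodule.span ℂ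
    (Set.range fun i => (Submodule.Quotient.mk (matGerm (G i)) : T1G F)) = ⊤

/-- The family of matrices `F_s = F + ∑ sᵢ Gᵢ` with base `ℂ^τ`. When the `Gᵢ` represent a basis
of `Mat(m,n;ℂ{x}) / (J_F + J_op)`, the spaces `F_s⁻¹(M_{m,n}^t)` are the fibres of the
`𝒢`-versal family of `F⁻¹(M_{m,n}^t)`. -/
def versalFamily (F : Cn N → Mat m n) {τ : ℕ} (G : Fin τ → Cn N → Mat m n) (s : Cn τ) :
    Cn N → Mat m n :=
  fun x => F x + ∑ i, s i • G i x

/-! ### The Tjurina transform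

The map `P` sends a matrix of rank exactly `t - 1` to its kernel, a point of the Grassmannian
`Grass(n-t+1, n)` of `(n-t+1)`-dimensional subspaces of `ℂⁿ`. The space `W` is the closure of the
graph of `P` in `M_{m,n} × Grass(n-t+1, n)`, with its reduced structure, and the Tjurina transform
of `X = F⁻¹(M_{m,n}^t)` is the fibre product `Y = X ×_{M_{m,n}^t} W`. -/

/-- The kernel of a matrix, as a subspace of `ℂⁿ`. -/
def matKer (A : Mat m n) : Submodule ℂ (EuclideanSpace ℂ (Fin n)) :=
  LinearMap.ker (Matrix.toLpLin 2 2 (Matrix.of A))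

/-- The coordinate space of the standard affine chart of the Grassmannian around the point `K`,
in which `0` corresponds to `K`. -/
abbrev GrChart (K : Submodule ℂ (EuclideanSpace ℂ (Fin n))) : Type := K →L[ℂ] Kᗮ

/-- The subspace with coordinate `φ` in the chart around `K`: the graph of `φ : K → Kᗮ`. -/
def chartPoint (K : Submodule ℂ (EuclideanSpace ℂ (Fin n))) (φ : GrChart K) :
    Submodule ℂ (EuclideanSpace ℂ (Fin n)) :=
  LinearMap.range (K.subtype + Kᗮ.subtype ∘ₗ (φ : K →ₗ[ℂ] Kᗮ))

/-- `W`, the closure of the graph of `P`, in the chart `M_{m,n} × GrChart K`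
of `M_{m,n} × Grass(n-t+1, n)`. -/
def tjurinaW (m : ℕ) (t : ℕ) (K : Submodule ℂ (EuclideanSpace ℂ (Fin n))) :
    Set (Mat m n × GrChart K) :=
  closure {w | (Matrix.of w.1).rank + 1 = t ∧ matKer w.1 = chartPoint K w.2}

/-- The ideal of `Y = X ×_{M_{m,n}^t} W ⊆ ℂ^N × Grass(n-t+1, n)` at the point `(p, K)`, in the
chart `ℂ^N × GrChart K`: it is generated by the equations of `X` and by the functions
`f(F(x), φ)`, where `f` is holomorphic at `(F(p), K)` and vanishes on `W`. -/
def tjurinaIdeal (t : ℕ) (F : Cn N → Mat m n) (p : Cn N)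
    (K : Submodule ℂ (EuclideanSpace ℂ (Fin n))) : Ideal (HolGerm ((p, 0) : Cn N × GrChart K)) :=
  Ideal.span
    ({g | ∃ (r : Fin t ↪o Fin m) (c : Fin t ↪o Fin n),
        g = germAt (fun y => ((Matrix.of (F y.1)).submatrix r c).det) (p, 0)} ∪
     {g | ∃ f : Mat m n × GrChart K → ℂ, AnalyticAt ℂ f (F p, 0) ∧
        (∀ᶠ w in 𝓝 (F p, 0), w ∈ tjurinaW m t K → f w = 0) ∧
        g = germAt (fun y => f (F y.1, y.2)) (p, 0)})

/-- `(p, K)` is a point of the Tjurina transform of `F⁻¹(M_{m,n}^t)`. -/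
def IsTjurinaPoint (t : ℕ) (F : Cn N → Mat m n) (p : Cn N)
    (K : Submodule ℂ (EuclideanSpace ℂ (Fin n))) : Prop :=
  Module.finrank ℂ K + t = n + 1 ∧ F p ∈ genericDet m n t ∧ (F p, 0) ∈ tjurinaW m t K

/-- `(p, K)` is a singular point of the Tjurina transform of `F⁻¹(M_{m,n}^t)`. -/
def IsTjurinaSingularAt (t : ℕ) (F : Cn N → Mat m n) (p : Cn N)
    (K : Submodule ℂ (EuclideanSpace ℂ (Fin n))) : Prop :=
  IsTjurinaPoint t F p K ∧
    ¬ IsRegularLocalRing (HolGerm ((p, 0) : Cn N × GrChart K) ⧸ tjurinaIdeal t F p K)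

/-! ### The discriminant and its two contributions

`𝓕 s` is the matrix of the fibre over `s`; the fibres are considered in `U ⊆ ℂ^N` and the base
is restricted to `S ⊆ ℂ^τ`. -/

variable {τ : ℕ}

/-- The base points over which the fibre has a singularity. -/
def discriminant (t : ℕ) (𝓕 : Cn τ → Cn N → Mat m n) (U : Set (Cn N)) (S : Set (Cn τ)) :
    Set (Cn τ) :=
  {s ∈ S | ∃ x ∈ U, IsSingularAt t (𝓕 s) x}

/-- Contribution (A): the base points over which the fibre has a determinantal singularity, that
is, a point at which all `(t-1)`-minors vanish. -/
def contributionA (t : ℕ) (𝓕 : Cn τ → Cn N → Mat m n) (U : Set (Cn N)) (S : Set (Cn τ)) :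
    Set (Cn τ) :=
  {s ∈ S | ∃ x ∈ U, ∀ (r : Fin (t - 1) ↪o Fin m) (c : Fin (t - 1) ↪o Fin n),
    ((Matrix.of (𝓕 s x)).submatrix r c).det = 0}

/-- Contribution (B): the base points over which the fibre has a singularity that gives a
singular point of its Tjurina transform. -/
def contributionB (t : ℕ) (𝓕 : Cn τ → Cn N → Mat m n) (U : Set (Cn N)) (S : Set (Cn τ)) :
    Set (Cn τ) :=
  {s ∈ S | ∃ x ∈ U, IsSingularAt t (𝓕 s) x ∧ ∃ K, IsTjurinaSingularAt t (𝓕 s) x K}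

/-- The part of contribution (B) that comes from points outside the locus of determinantal
singularities, that is, from points at which the matrix has rank exactly `t - 1`. -/
def contributionB' (t : ℕ) (𝓕 : Cn τ → Cn N → Mat m n) (U : Set (Cn N)) (S : Set (Cn τ)) :
    Set (Cn τ) :=
  {s ∈ S | ∃ x ∈ U, (Matrix.of (𝓕 s x)).rank + 1 = t ∧ IsSingularAt t (𝓕 s) x ∧
    ∃ K, IsTjurinaSingularAt t (𝓕 s) x K}

end Spaces

end DetSing

end

/-!
Let `p` be a point of which no neighbourhood lies in `F⁻¹(M_{m,n}^t)`, that is, the ideal of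
`t`-minors is not zero. For a determinantal singularity this holds at `0` because the codimension
is positive, and by the identity theorem it persists at all nearby points of nearby fibres.

If `rk F(p) < t - 1`, every `t`-minor vanishes at `p` to second order, since its differential is a
combination of `(t-1)`-minors of `F(p)`. The Zariski tangent space of `X` at `p` is then all of
`ℂ^N`, while `dim X < N`, so `X` is singular.

If `rk F(p) = t - 1`, the map `A ↦ ker A` on the matrices of rank `t - 1` near `F(p)` extends to a
holomorphic map `P` into the Grassmannian, and near `(F(p), ker F(p))` the space `W` lies in the
graph of `P`. Hence `Y` lies in the graph of `P ∘ F`, and it coincides with the part of this graph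
over `X` because every holomorphic function vanishing on the matrices of rank `t - 1` is, at such
a matrix, in the ideal of the `t`-minors. So `Y → X` is a local isomorphism at the only point of
`Y` over `p`.
-/

noncomputable section

namespace DetSing

section DividedDifference

open MeasureTheory

variable {V F : Type*} [NormedAddCommGroup V] [NormedSpace ℂ V] [NormedAddCommGroup F]
  [NormedSpace ℂ F]

theorem hasFPowerSeriesOnBall_intervalIntegral [CompleteSpace F] {a b : ℝ} {g : ℝ → V → F}
    {q : ℝ → FormalMultilinearSeries ℂ V F} {C : ℕ → ℝ} {w : V} {r : ENNReal} (hr : 0 < r)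
    (hg : ∀ s ∈ Set.uIcc a b, HasFPowerSeriesOnBall (g s) (q s) w r)
    (hq : ∀ n, Continuous fun s => q s n) (hqC : ∀ n, ∀ s ∈ Set.uIcc a b, ‖q s n‖ ≤ C n)
    (hC : ∀ ρ : NNReal, ρ < r → Summable fun n => C n * (ρ : ℝ) ^ n) :
    HasFPowerSeriesOnBall (fun y => ∫ s in a..b, g s y) (fun n => ∫ s in a..b, q s n) w r := by
  refine ⟨ENNReal.le_of_forall_nnreal_lt fun ρ hρ =>
    FormalMultilinearSeries.le_radius_of_summable_norm _ ?_, hr, fun {y} hy => ?_⟩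
  · refine Summable.of_nonneg_of_le (fun n => by positivity) (fun n => ?_)
      ((hC ρ hρ).mul_right |b - a|)
    have hint : ‖∫ s in a..b, q s n‖ ≤ C n * |b - a| :=
      intervalIntegral.norm_integral_le_of_norm_le_const fun s hs =>
        hqC n s (Set.uIoc_subset_uIcc hs)
    calc ‖∫ s in a..b, q s n‖ * (ρ : ℝ) ^ n ≤ C n * |b - a| * (ρ : ℝ) ^ n := by gcongr
      _ = C n * (ρ : ℝ) ^ n * |b - a| := by ring
  · have hy' : (‖y‖₊ : ENNReal) < r := by simpa [enorm_eq_nnnorm] using hy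
    have hcoeff (n : ℕ) : (∫ s in a..b, q s n) (fun _ => y) = ∫ s in a..b, q s n fun _ => y :=
      ((ContinuousMultilinearMap.apply ℂ (fun _ : Fin n => V) F
        fun _ => y).intervalIntegral_comp_comm ((hq n).intervalIntegrable a b)).symm
    simp only [hcoeff]
    refine intervalIntegral.hasSum_integral_of_dominated_convergence
      (fun n _ => C n * ‖y‖ ^ n) (fun n => ?_) (fun n => .of_forall fun s hs => ?_)
      (.of_forall fun _ _ => hC ‖y‖₊ hy') intervalIntegrable_const (.of_forall fun s hs => ?_)
    · exact ((ContinuousMultilinearMap.apply ℂ (fun _ : Fin n => V) F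
        fun _ => y).continuous.comp (hq n)).aestronglyMeasurable
    · refine ((q s n).le_opNorm _).trans ?_
      simpa using mul_le_mul_of_nonneg_right (hqC n s (Set.uIoc_subset_uIcc hs))
        (pow_nonneg (norm_nonneg y) n)
    · exact (hg s (Set.uIoc_subset_uIcc hs)).hasSum hy

/-- The linear map `(x, y) ↦ (1 - s) y + s x`, whose values for `s ∈ [0, 1]` run through the
segment from `y` to `x`. -/
def segmentMap (V : Type*) [NormedAddCommGroup V] [NormedSpace ℂ V] (s : ℝ) : V × V →L[ℂ] V :=
  AffineMap.lineMap (ContinuousLinearMap.snd ℂ V V) (ContinuousLinearMap.fst ℂ V V) s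

lemma segmentMap_apply (s : ℝ) (y : V × V) :
    segmentMap V s y = AffineMap.lineMap y.2 y.1 s := by
  simp [segmentMap, AffineMap.lineMap_apply_module]

lemma continuous_segmentMap : Continuous (segmentMap V) :=
  AffineMap.lineMap_continuous

lemma norm_segmentMap_le {s : ℝ} (hs : s ∈ Set.Icc (0 : ℝ) 1) : ‖segmentMap V s‖ ≤ 1 := by
  have h := (convex_closedBall (0 : V × V →L[ℂ] V) 1).lineMap_mem
    (mem_closedBall_zero_iff.2 (ContinuousLinearMap.norm_snd_le ℂ V V))
    (mem_closedBall_zero_iff.2 (ContinuousLinearMap.norm_fst_le ℂ V V)) hs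
  exact mem_closedBall_zero_iff.1 h

lemma hasFPowerSeriesOnBall_comp_segmentMap {g : V → F} {q : FormalMultilinearSeries ℂ V F}
    {w : V} {r : ENNReal} (hg : HasFPowerSeriesOnBall g q w r) {s : ℝ}
    (hs : s ∈ Set.Icc (0 : ℝ) 1) :
    HasFPowerSeriesOnBall (fun y => g (segmentMap V s y))
      (q.compContinuousLinearMap (segmentMap V s)) (w, w) r := by
  have hw : segmentMap V s (w, w) = w := by simp [segmentMap_apply]
  have hle : ‖segmentMap V s‖ₑ ≤ ‖(1 : ℂ)‖ₑ :=
    enorm_le_iff_norm_le.2 (by simpa using norm_segmentMap_le hs)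
  refine (HasFPowerSeriesOnBall.compContinuousLinearMap (u := segmentMap V s) (x := (w, w))
    (by rwa [hw])).mono hg.r_pos ?_
  simpa using ENNReal.div_le_div_left hle r

lemma hasFPowerSeriesOnBall_integral_comp_segmentMap [CompleteSpace F] {g : V → F}
    {q : FormalMultilinearSeries ℂ V F} {w : V} {r : ENNReal}
    (hg : HasFPowerSeriesOnBall g q w r) :
    HasFPowerSeriesOnBall (fun y => ∫ s in (0 : ℝ)..1, g (segmentMap V s y))
      (fun n => ∫ s in (0 : ℝ)..1, q.compContinuousLinearMap (segmentMap V s) n) (w, w) r := by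
  refine hasFPowerSeriesOnBall_intervalIntegral (C := fun n => ‖q n‖) hg.r_pos
    (fun s hs => hasFPowerSeriesOnBall_comp_segmentMap hg (Set.uIcc_of_le (zero_le_one' ℝ) ▸ hs))
    (fun n => ?_) (fun n s hs => ?_) fun ρ hρ => q.summable_norm_mul_pow (hρ.trans_le hg.r_le)
  · exact ((ContinuousMultilinearMap.compContinuousLinearMapContinuousMultilinear ℂ
      (fun _ : Fin n => V × V) (fun _ : Fin n => V) F).cont.comp
        (continuous_pi fun _ => continuous_segmentMap)).clm_apply continuous_const
  · refine ((q n).norm_compContinuousLinearMap_le _).trans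
      (mul_le_of_le_one_right (norm_nonneg _) (Finset.prod_le_one (fun _ _ => norm_nonneg _)
        fun _ _ => norm_segmentMap_le (Set.uIcc_of_le (zero_le_one' ℝ) ▸ hs)))

lemma sub_eq_integral_fderiv_segmentMap [CompleteSpace F] {f : V → F} {y : V × V}
    (hf : ∀ s ∈ Set.uIcc (0 : ℝ) 1, AnalyticAt ℂ f (segmentMap V s y)) :
    f y.1 - f y.2 = (∫ s in (0 : ℝ)..1, fderiv ℂ f (segmentMap V s y)) (y.1 - y.2) := by
  have hcont : ContinuousOn (fun s : ℝ => fderiv ℂ f (segmentMap V s y)) (Set.uIcc 0 1) :=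
    fun s hs => ((hf s hs).fderiv.continuousAt.comp (f := fun s => segmentMap V s y)
      (continuous_segmentMap.clm_apply continuous_const).continuousAt).continuousWithinAt
  have hderiv : ∀ s ∈ Set.uIcc (0 : ℝ) 1, HasDerivAt (fun s : ℝ => f (segmentMap V s y))
      (fderiv ℂ f (segmentMap V s y) (y.1 - y.2)) s := fun s hs => by
    have hseg : HasDerivAt (fun s : ℝ => segmentMap V s y) (y.1 - y.2) s := by
      simpa only [segmentMap_apply] using
        AffineMap.hasDerivAt_lineMap (𝕜 := ℝ) (a := y.2) (b := y.1)
    exact ((hf s hs).differentiableAt.hasFDerivAt.restrictScalars ℝ).comp_hasDerivAt s hseg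
  calc f y.1 - f y.2 = f (segmentMap V 1 y) - f (segmentMap V 0 y) := by simp [segmentMap_apply]
    _ = ∫ s in (0 : ℝ)..1, fderiv ℂ f (segmentMap V s y) (y.1 - y.2) :=
      (intervalIntegral.integral_eq_sub_of_hasDerivAt hderiv
        (hcont.clm_apply continuousOn_const).intervalIntegrable).symm
    _ = _ := (ContinuousLinearMap.apply ℂ F (y.1 - y.2)).intervalIntegral_comp_comm
      hcont.intervalIntegrable

theorem exists_analyticAt_sub_eq [CompleteSpace F] {f : V → F} {w : V} (hf : AnalyticAt ℂ f w) :
    ∃ h : V × V → (V →L[ℂ] F), AnalyticAt ℂ h (w, w) ∧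
      ∀ᶠ y in 𝓝 (w, w), f y.1 - f y.2 = h y (y.1 - y.2) := by
  obtain ⟨q, r, hq⟩ := hf
  refine ⟨fun y => ∫ s in (0 : ℝ)..1, fderiv ℂ f (segmentMap V s y),
    (hasFPowerSeriesOnBall_integral_comp_segmentMap hq.fderiv).analyticAt, ?_⟩
  filter_upwards [Metric.eball_mem_nhds (w, w) hq.r_pos] with y hy
  refine sub_eq_integral_fderiv_segmentMap fun s hs => hq.analyticAt_of_mem ?_
  have hy' : y.1 ∈ Metric.eball w r ∧ y.2 ∈ Metric.eball w r := by
    simpa [Metric.mem_eball, Prod.edist_eq] using hy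
  rw [segmentMap_apply]
  exact (convex_eball w r).lineMap_mem hy'.2 hy'.1 (Set.uIcc_of_le (zero_le_one' ℝ) ▸ hs)

end DividedDifference

section GermCalculus

variable {V W : Type*} [NormedAddCommGroup V] [NormedSpace ℂ V] [NormedAddCommGroup W]
  [NormedSpace ℂ W] {p : V} {f g : V → ℂ}

lemma coe_germAt (hf : AnalyticAt ℂ f p) :
    (germAt f p : Germ (𝓝 p) ℂ) = (f : Germ (𝓝 p) ℂ) := by
  rw [germAt, dif_pos hf]

lemma germAt_eq_germAt_iff (hf : AnalyticAt ℂ f p) (hg : AnalyticAt ℂ g p) :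
    germAt f p = germAt g p ↔ f =ᶠ[𝓝 p] g := by
  rw [Subtype.ext_iff, coe_germAt hf, coe_germAt hg, Germ.coe_eq]

lemma exists_germAt_eq (a : HolGerm p) : ∃ f : V → ℂ, AnalyticAt ℂ f p ∧ germAt f p = a := by
  obtain ⟨f, hf, h⟩ := a.2
  exact ⟨f, hf, Subtype.ext ((coe_germAt hf).trans h)⟩

lemma germAt_add (hf : AnalyticAt ℂ f p) (hg : AnalyticAt ℂ g p) :
    germAt (fun x => f x + g x) p = germAt f p + germAt g p := by
  apply Subtype.ext
  rw [Subring.coe_add, coe_germAt hf, coe_germAt hg, coe_germAt (hf.fun_add hg)]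
  rfl

lemma germAt_sub (hf : AnalyticAt ℂ f p) (hg : AnalyticAt ℂ g p) :
    germAt (fun x => f x - g x) p = germAt f p - germAt g p := by
  apply Subtype.ext
  rw [AddSubgroupClass.coe_sub, coe_germAt hf, coe_germAt hg, coe_germAt (hf.fun_sub hg)]
  rfl

lemma germAt_mul (hf : AnalyticAt ℂ f p) (hg : AnalyticAt ℂ g p) :
    germAt (fun x => f x * g x) p = germAt f p * germAt g p := by
  apply Subtype.ext
  rw [Subring.coe_mul, coe_germAt hf, coe_germAt hg, coe_germAt (hf.fun_mul hg)]
  rfl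

lemma germAt_zero : germAt (fun _ => 0) p = 0 := by
  apply Subtype.ext
  rw [coe_germAt analyticAt_const]
  rfl

lemma germAt_one : germAt (fun _ => 1) p = 1 := by
  apply Subtype.ext
  rw [coe_germAt analyticAt_const]
  rfl

lemma germAt_sum {ι : Type*} (s : Finset ι) {f : ι → V → ℂ} (hf : ∀ i, AnalyticAt ℂ (f i) p) :
    germAt (fun x => ∑ i ∈ s, f i x) p = ∑ i ∈ s, germAt (f i) p := by
  classical
  induction s using Finset.induction_on with
  | empty => simpa using germAt_zero
  | insert i s hi ih =>
    simp_rw [Finset.sum_insert hi]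
    rw [germAt_add (hf i) (Finset.analyticAt_fun_sum _ fun j _ => hf j), ih]

lemma germAt_pow (hf : AnalyticAt ℂ f p) (n : ℕ) :
    germAt (fun x => f x ^ n) p = germAt f p ^ n := by
  induction n with
  | zero => simpa using germAt_one
  | succ n ih => simp_rw [pow_succ]; rw [germAt_mul (hf.fun_pow n) hf, ih]

lemma germAt_congr (h : f =ᶠ[𝓝 p] g) : germAt f p = germAt g p := by
  by_cases hf : AnalyticAt ℂ f p
  · exact (germAt_eq_germAt_iff hf (hf.congr h)).2 h
  · rw [germAt, germAt, dif_neg hf, dif_neg fun hg => hf (hg.congr h.symm)]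

/-- The value of a germ at its base point. -/
def germEval (p : V) : HolGerm p →+* ℂ := Germ.valueRingHom.comp (holSubring p).subtype

lemma germEval_germAt (hf : AnalyticAt ℂ f p) : germEval p (germAt f p) = f p := by
  change Germ.value (germAt f p : Germ (𝓝 p) ℂ) = f p
  rw [coe_germAt hf]
  rfl

lemma isUnit_iff_germEval_ne_zero (a : HolGerm p) : IsUnit a ↔ germEval p a ≠ 0 := by
  refine ⟨fun ha => (ha.map (germEval p)).ne_zero, fun ha => ?_⟩
  obtain ⟨f, hf, rfl⟩ := exists_germAt_eq a
  rw [germEval_germAt hf] at ha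
  refine .of_mul_eq_one (germAt (fun x => (f x)⁻¹) p) ?_
  rw [← germAt_mul hf (hf.fun_inv ha), ← germAt_one]
  refine germAt_congr ?_
  filter_upwards [hf.continuousAt.eventually_ne ha] with x hx using mul_inv_cancel₀ hx

instance : IsLocalHom (germEval p) :=
  ⟨fun a ha => (isUnit_iff_germEval_ne_zero a).2 ha.ne_zero⟩

instance : IsLocalRing (HolGerm p) := RingHom.domain_isLocalRing (germEval p)

/-- The differential of a germ at its base point. -/
def germFDeriv (p : V) (a : HolGerm p) : V →L[ℂ] ℂ := fderiv ℂ (exists_germAt_eq a).choose p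

lemma germFDeriv_germAt (hf : AnalyticAt ℂ f p) : germFDeriv p (germAt f p) = fderiv ℂ f p := by
  have h := (exists_germAt_eq (germAt f p)).choose_spec
  exact ((germAt_eq_germAt_iff h.1 hf).1 h.2).fderiv_eq

/-- The 1-jet `f(p) + ε df(p)` of a germ `f` at its base point; the kernel is the ideal of the
germs that vanish to second order. -/
def germJet (p : V) : HolGerm p →+* TrivSqZeroExt ℂ (V →L[ℂ] ℂ) where
  toFun a := .inl (germEval p a) + .inr (germFDeriv p a)
  map_one' := by
    rw [← germAt_one, germFDeriv_germAt analyticAt_const, germAt_one]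
    simp
  map_zero' := by
    rw [← germAt_zero, germFDeriv_germAt analyticAt_const, germAt_zero]
    simp
  map_mul' a b := by
    obtain ⟨f, hf, rfl⟩ := exists_germAt_eq a
    obtain ⟨g, hg, rfl⟩ := exists_germAt_eq b
    rw [← germAt_mul hf hg, germFDeriv_germAt hf, germFDeriv_germAt hg,
      germFDeriv_germAt (hf.fun_mul hg), fderiv_fun_mul hf.differentiableAt hg.differentiableAt,
      germEval_germAt hf, germEval_germAt hg, germEval_germAt (hf.fun_mul hg)]
    ext : 1 <;> simp
  map_add' a b := by
    obtain ⟨f, hf, rfl⟩ := exists_germAt_eq a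
    obtain ⟨g, hg, rfl⟩ := exists_germAt_eq b
    rw [← germAt_add hf hg, germFDeriv_germAt hf, germFDeriv_germAt hg,
      germFDeriv_germAt (hf.fun_add hg), fderiv_fun_add hf.differentiableAt hg.differentiableAt,
      germEval_germAt hf, germEval_germAt hg, germEval_germAt (hf.fun_add hg)]
    ext : 1 <;> simp

lemma germJet_germAt (hf : AnalyticAt ℂ f p) :
    germJet p (germAt f p) = .inl (f p) + .inr (fderiv ℂ f p) := by
  rw [← germEval_germAt hf, ← germFDeriv_germAt hf]
  rfl

lemma fst_germJet (a : HolGerm p) : (germJet p a).fst = germEval p a := by simp [germJet]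

/-- The pullback of germs along an analytic map. -/
def germPullback {q : W} (ψ : V → W) (hψ : AnalyticAt ℂ ψ p) (hq : ψ p = q) :
    HolGerm q →+* HolGerm p where
  toFun a := ⟨(a : Germ (𝓝 q) ℂ).compTendsto ψ (hq ▸ hψ.continuousAt), by
    obtain ⟨f, hf, h⟩ := a.2
    refine ⟨f ∘ ψ, AnalyticAt.comp (hq ▸ hf) hψ, ?_⟩
    rw [← h]
    rfl⟩
  map_one' := rfl
  map_zero' := rfl
  map_mul' := by
    rintro ⟨a, f, hf, rfl⟩ ⟨b, g, hg, rfl⟩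
    rfl
  map_add' := by
    rintro ⟨a, f, hf, rfl⟩ ⟨b, g, hg, rfl⟩
    rfl

lemma germPullback_germAt {q : W} {ψ : V → W} (hψ : AnalyticAt ℂ ψ p) (hq : ψ p = q)
    {f : W → ℂ} (hf : AnalyticAt ℂ f q) :
    germPullback ψ hψ hq (germAt f q) = germAt (fun x => f (ψ x)) p := by
  apply Subtype.ext
  rw [coe_germAt (f := fun x => f (ψ x)) (AnalyticAt.fun_comp (hq ▸ hf) hψ)]
  change Germ.compTendsto (germAt f q : Germ (𝓝 q) ℂ) ψ
    (hq ▸ hψ.continuousAt : Tendsto ψ (𝓝 p) (𝓝 q)) = _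
  simp_rw [coe_germAt hf]
  rfl

theorem germAt_comp_sub_mem {ι : Type*} [Finite ι] (e : Module.Basis ι ℂ W) {w : W} {f : W → ℂ}
    (hf : AnalyticAt ℂ f w) {a b : V → W} (ha : AnalyticAt ℂ a p) (hb : AnalyticAt ℂ b p)
    (haw : a p = w) (hbw : b p = w) {J : Ideal (HolGerm p)}
    (hJ : ∀ i, germAt (fun x => e.repr (a x - b x) i) p ∈ J) :
    germAt (fun x => f (a x)) p - germAt (fun x => f (b x)) p ∈ J := by
  have := Fintype.ofFinite ι
  have : FiniteDimensional ℂ W := .of_basis e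
  have := FiniteDimensional.complete ℂ W
  obtain ⟨h, hh, he⟩ := exists_analyticAt_sub_eq hf
  have hab : AnalyticAt ℂ (fun x => (a x, b x)) p := ha.prod hb
  have hh' : AnalyticAt ℂ (fun x => h (a x, b x)) p :=
    AnalyticAt.fun_comp (g := h) (by simpa only [haw, hbw] using hh) hab
  have hi (i) : AnalyticAt ℂ (fun x => h (a x, b x) (e i)) p :=
    ((ContinuousLinearMap.apply ℂ ℂ (e i)).analyticAt _).fun_comp hh'
  have hc (i) : AnalyticAt ℂ (fun x => e.repr (a x - b x) i) p :=
    ((e.coord i).toContinuousLinearMap.analyticAt _).fun_comp (ha.fun_sub hb)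
  have hev : ∀ᶠ x in 𝓝 p,
      f (a x) - f (b x) = ∑ i, e.repr (a x - b x) i * h (a x, b x) (e i) := by
    have ht : Tendsto (fun x => (a x, b x)) (𝓝 p) (𝓝 (w, w)) := by
      simpa only [haw, hbw] using hab.continuousAt.tendsto
    filter_upwards [ht.eventually he] with x hx
    rw [hx]
    conv_lhs => rw [← e.sum_repr (a x - b x)]
    simp
  rw [← germAt_sub (AnalyticAt.fun_comp (haw ▸ hf) ha) (AnalyticAt.fun_comp (hbw ▸ hf) hb),
    germAt_congr hev, germAt_sum _ fun i => (hc i).fun_mul (hi i)]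
  refine Ideal.sum_mem _ fun i _ => ?_
  rw [germAt_mul (hc i) (hi i)]
  exact J.mul_mem_right _ (hJ _)

lemma eventually_eq_zero_or_of_mul_eq_zero {f g : V → ℂ} (hf : AnalyticAt ℂ f p)
    (hg : AnalyticAt ℂ g p) (h : ∀ᶠ x in 𝓝 p, f x * g x = 0) :
    (∀ᶠ x in 𝓝 p, f x = 0) ∨ ∀ᶠ x in 𝓝 p, g x = 0 := by
  by_contra! hc
  obtain ⟨r, hr, hball⟩ := Metric.eventually_nhds_iff_ball.1
    (hf.eventually_analyticAt.and (hg.eventually_analyticAt.and h))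
  obtain ⟨x, hx, hxb⟩ := (hc.1.and_eventually (Metric.ball_mem_nhds p hr)).exists
  have hb : Metric.ball p r ∈ 𝓝 x := Metric.isOpen_ball.mem_nhds hxb
  have hg0 : g =ᶠ[𝓝 x] 0 := by
    filter_upwards [(hball x hxb).1.continuousAt.eventually_ne hx, hb] with y hy hyb
    exact (mul_eq_zero.1 (hball y hyb).2.2).resolve_left hy
  have han : AnalyticOnNhd ℂ g (Metric.ball p r) := fun y hy => (hball y hy).2.1
  have := han.eqOn_zero_of_preconnected_of_eventuallyEq_zero
    (convex_ball p r).isPreconnected hxb hg0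
  exact hc.2 (Filter.mem_of_superset (Metric.ball_mem_nhds p hr) fun y hy => not_not.2 (this hy))

instance : IsDomain (HolGerm p) := by
  have : Nontrivial (HolGerm p) := (germEval p).domain_nontrivial
  have : NoZeroDivisors (HolGerm p) := ⟨by
    intro a b hab
    obtain ⟨f, hf, rfl⟩ := exists_germAt_eq a
    obtain ⟨g, hg, rfl⟩ := exists_germAt_eq b
    rw [← germAt_mul hf hg, ← germAt_zero,
      germAt_eq_germAt_iff (hf.fun_mul hg) analyticAt_const] at hab
    rw [← germAt_zero, germAt_eq_germAt_iff hf analyticAt_const,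
      germAt_eq_germAt_iff hg analyticAt_const]
    exact eventually_eq_zero_or_of_mul_eq_zero hf hg hab⟩
  exact NoZeroDivisors.to_isDomain _

end GermCalculus

section LinearGerms

variable {U V : Type*} [NormedAddCommGroup U] [NormedSpace ℂ U] [NormedAddCommGroup V]
  [NormedSpace ℂ V] {p : V}

lemma analyticAt_clm_sub {E : Type*} [NormedAddCommGroup E] [NormedSpace ℂ E] (μ : V →L[ℂ] E)
    (p : V) : AnalyticAt ℂ (fun x => μ (x - p)) p :=
  (μ.analyticAt _).fun_comp (analyticAt_id.fun_sub analyticAt_const)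

/-- The germ at `p` of the linear coordinate `x ↦ μ (x - p)`. -/
def linGerm (p : V) : (V →L[ℂ] ℂ) →ₗ[ℂ] HolGerm p where
  toFun μ := germAt (fun x => μ (x - p)) p
  map_add' μ ν := germAt_add (analyticAt_clm_sub μ p) (analyticAt_clm_sub ν p)
  map_smul' c μ := (germAt_mul analyticAt_const (analyticAt_clm_sub μ p)).trans <| by
    rw [RingHom.id_apply, Algebra.smul_def]
    congr 1
    exact Subtype.ext (coe_germAt analyticAt_const)

lemma linGerm_apply (μ : V →L[ℂ] ℂ) : linGerm p μ = germAt (fun x => μ (x - p)) p := rfl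

lemma germJet_linGerm (μ : V →L[ℂ] ℂ) : germJet p (linGerm p μ) = .inr μ := by
  have hμ : HasFDerivAt (fun x => μ (x - p)) (μ.comp (ContinuousLinearMap.id ℂ V)) p :=
    μ.hasFDerivAt.comp p ((hasFDerivAt_id p).sub_const p)
  rw [linGerm_apply, germJet_germAt (analyticAt_clm_sub μ p), hμ.fderiv]
  ext : 1 <;> simp

lemma germEval_linGerm (μ : V →L[ℂ] ℂ) : germEval p (linGerm p μ) = 0 := by
  rw [← fst_germJet, germJet_linGerm, TrivSqZeroExt.fst_inr]

lemma linGerm_ne_zero {μ : V →L[ℂ] ℂ} (hμ : μ ≠ 0) : linGerm p μ ≠ 0 := fun h =>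
  hμ (TrivSqZeroExt.inr_injective (by rw [← germJet_linGerm (p := p), h, map_zero,
    TrivSqZeroExt.inr_zero]))

lemma germJet_surjective (p : V) : Function.Surjective (germJet p) := fun j => by
  refine ⟨germAt (fun x => j.fst + j.snd (x - p)) p, ?_⟩
  have hlin := analyticAt_clm_sub j.snd p
  rw [germAt_add analyticAt_const hlin, map_add, germJet_germAt analyticAt_const,
    ← linGerm_apply, germJet_linGerm]
  ext : 1 <;> simp

/-- The restriction of germs at `p` to the affine subspace `p + L(U)`. -/
def germRestrict (p : V) (L : U →L[ℂ] V) : HolGerm p →+* HolGerm (0 : U) :=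
  germPullback (fun u => p + L u) (analyticAt_const.fun_add (L.analyticAt 0)) (by simp)

/-- The extension of germs on `U` to `V`, constant along the fibres of `R : V → U`. -/
def germExtend (p : V) (R : V →L[ℂ] U) : HolGerm (0 : U) →+* HolGerm p :=
  germPullback (fun x => R (x - p)) (analyticAt_clm_sub R p) (by simp)

variable {L : U →L[ℂ] V} {R : V →L[ℂ] U}

lemma germRestrict_germAt (L : U →L[ℂ] V) {f : V → ℂ} (hf : AnalyticAt ℂ f p) :
    germRestrict p L (germAt f p) = germAt (fun u => f (p + L u)) 0 :=
  germPullback_germAt _ _ hf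

lemma germExtend_germAt (R : V →L[ℂ] U) {f : U → ℂ} (hf : AnalyticAt ℂ f 0) :
    germExtend p R (germAt f 0) = germAt (fun x => f (R (x - p))) p :=
  germPullback_germAt _ _ hf

lemma germRestrict_linGerm (L : U →L[ℂ] V) (μ : V →L[ℂ] ℂ) :
    germRestrict p L (linGerm p μ) = linGerm 0 (μ ∘L L) := by
  rw [linGerm_apply, germRestrict_germAt L (analyticAt_clm_sub μ p), linGerm_apply]
  simp

lemma germRestrict_surjective (hRL : Function.LeftInverse R L) :
    Function.Surjective (germRestrict p L) := fun a => by
  obtain ⟨f, hf, rfl⟩ := exists_germAt_eq a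
  have hfR : AnalyticAt ℂ (fun x => f (R (x - p))) p :=
    AnalyticAt.fun_comp (by simpa using hf) (analyticAt_clm_sub R p)
  exact ⟨germAt (fun x => f (R (x - p))) p, by
    rw [germRestrict_germAt L hfR]; simp [hRL _]⟩

theorem sub_germExtend_germRestrict_mem [FiniteDimensional ℂ V] (hRL : Function.LeftInverse R L)
    {J : Ideal (HolGerm p)} (hJ : ∀ μ : V →L[ℂ] ℂ, μ ∘L L = 0 → linGerm p μ ∈ J)
    (a : HolGerm p) : a - germExtend p R (germRestrict p L a) ∈ J := by
  obtain ⟨f, hf, rfl⟩ := exists_germAt_eq a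
  have hfL : AnalyticAt ℂ (fun u => f (p + L u)) 0 :=
    AnalyticAt.fun_comp (by simpa using hf) (analyticAt_const.fun_add (L.analyticAt 0))
  rw [germRestrict_germAt L hf, germExtend_germAt R hfL]
  refine germAt_comp_sub_mem (Module.finBasis ℂ V) hf analyticAt_id
    (analyticAt_const.fun_add (analyticAt_clm_sub (L ∘L R) p)) rfl (by simp) fun i => ?_
  let ℓ : V →L[ℂ] ℂ := ((Module.finBasis ℂ V).coord i).toContinuousLinearMap
  convert hJ (ℓ - ℓ ∘L L ∘L R) (by ext u; simp [hRL u]) using 1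
  rw [linGerm_apply]
  congr 1
  funext x
  change ℓ (x - (p + L (R (x - p)))) = ℓ (x - p) - ℓ (L (R (x - p)))
  rw [← map_sub, sub_sub]

end LinearGerms

section Dimension

open IsDiscreteValuationRing in
instance isDiscreteValuationRing_holGerm (z : ℂ) : IsDiscreteValuationRing (HolGerm z) := by
  let ϖ : HolGerm z := linGerm z (.id ℂ ℂ)
  have hϖ : Irreducible ϖ := by
    refine ⟨fun h => (isUnit_iff_germEval_ne_zero _).1 h (germEval_linGerm _), fun a b hab => ?_⟩
    have hjet := congrArg TrivSqZeroExt.snd (congrArg (germJet z) hab)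
    rw [germJet_linGerm, map_mul] at hjet
    by_contra! h
    simp only [isUnit_iff_germEval_ne_zero, ne_eq, not_not] at h
    simpa [fst_germJet, h.1, h.2] using DFunLike.congr_fun hjet 1
  refine ofHasUnitMulPowIrreducibleFactorization ⟨ϖ, hϖ, fun {a} ha => ?_⟩
  obtain ⟨f, hf, rfl⟩ := exists_germAt_eq a
  have hf0 : ¬ ∀ᶠ w in 𝓝 z, f w = 0 := by
    rwa [← germAt_zero, Ne, germAt_eq_germAt_iff hf analyticAt_const] at ha
  obtain ⟨n, g, hg, hg0, hfg⟩ := hf.exists_eventuallyEq_pow_smul_nonzero_iff.2 hf0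
  have hid := analyticAt_clm_sub (.id ℂ ℂ) z
  have hgu : IsUnit (germAt g z) := by
    rwa [isUnit_iff_germEval_ne_zero, germEval_germAt hg]
  refine ⟨n, hgu.unit, ?_⟩
  calc ϖ ^ n * hgu.unit = germAt (fun w => ContinuousLinearMap.id ℂ ℂ (w - z) ^ n * g w) z := by
        rw [germAt_mul (hid.fun_pow n) hg, germAt_pow hid]
        rfl
    _ = germAt f z := germAt_congr (hfg.mono fun w hw => hw.symm)

theorem finrank_le_ringKrullDim_holGerm {V : Type*} [NormedAddCommGroup V] [NormedSpace ℂ V]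
    [FiniteDimensional ℂ V] (p : V) :
    (Module.finrank ℂ V : WithBot ℕ∞) ≤ ringKrullDim (HolGerm p) := by
  induction hn : Module.finrank ℂ V generalizing V with
  | zero => exact ringKrullDim_nonneg_of_nontrivial
  | succ n ih =>
    have : Nontrivial V := Module.nontrivial_of_finrank_pos (R := ℂ) (by omega)
    obtain ⟨v, hv⟩ := exists_ne (0 : V)
    obtain ⟨μ, hμ⟩ := SeparatingDual.exists_eq_one (R := ℂ) hv
    have hμ0 : μ ≠ 0 := by rintro rfl; simp at hμ
    have hH : Module.finrank ℂ μ.ker = n := by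
      have := Module.Dual.finrank_ker_add_one_of_ne_zero (f := μ.toLinearMap)
        fun h => hμ0 (ContinuousLinearMap.coe_injective h)
      omega
    obtain ⟨R, hR⟩ := μ.ker.subtype.exists_leftInverse_of_injective (by simp)
    calc ((n + 1 : ℕ) : WithBot ℕ∞) ≤ ringKrullDim (HolGerm (0 : μ.ker)) + 1 := by
          push_cast; gcongr; exact ih 0 hH
      _ ≤ ringKrullDim (HolGerm p) := ringKrullDim_succ_le_of_surjective
          (germRestrict p μ.ker.subtypeL)
          (germRestrict_surjective (R := R.toContinuousLinearMap) fun x =>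
            LinearMap.congr_fun hR x)
          (mem_nonZeroDivisors_of_ne_zero (linGerm_ne_zero hμ0))
          (by rw [germRestrict_linGerm, (by ext x; simp : μ ∘L μ.ker.subtypeL = 0), map_zero])

end Dimension

section NonRegular

theorem finrank_le_spanFinrank_ker_fst {A K M : Type*} [CommRing A] [Field K] [AddCommGroup M]
    [Module K M] [Module Kᵐᵒᵖ M] [IsCentralScalar K M] {φ : A →+* TrivSqZeroExt K M}
    (hφ : Function.Surjective φ)
    (hfg : (RingHom.ker ((TrivSqZeroExt.fstHom K K M).toRingHom.comp φ)).FG) :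
    Module.finrank K M ≤
      (RingHom.ker ((TrivSqZeroExt.fstHom K K M).toRingHom.comp φ)).spanFinrank := by
  classical
  obtain ⟨s, hs, hspan⟩ := Submodule.FG.exists_span_finset_card_eq_spanFinrank hfg
  have hmem (a : A) : a ∈ Submodule.span A (s : Set A) ↔ (φ a).fst = 0 := by
    rw [hspan]; rfl
  have hsnd : ∀ a ∈ Submodule.span A (s : Set A),
      (φ a).snd ∈ Submodule.span K (s.image fun a => (φ a).snd : Set M) := fun a ha => by
    induction ha using Submodule.span_induction with
    | mem a ha => exact Submodule.subset_span (by simpa using ⟨a, ha, rfl⟩)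
    | zero => simp
    | add a b _ _ ha hb => simpa using Submodule.add_mem _ ha hb
    | smul c a has ha => simpa [(hmem a).1 has] using Submodule.smul_mem _ _ ha
  have htop : Submodule.span K (s.image fun a => (φ a).snd : Set M) = ⊤ := by
    refine eq_top_iff.2 fun m _ => ?_
    obtain ⟨a, ha⟩ := hφ (.inr m)
    simpa [ha] using hsnd a ((hmem a).2 (by simp [ha]))
  calc Module.finrank K M = Module.finrank K (⊤ : Submodule K M) := by rw [finrank_top]
    _ ≤ (s.image fun a => (φ a).snd).card := by
      rw [← htop]; exact finrank_span_finset_le_card _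
    _ ≤ s.card := Finset.card_image_le
    _ = _ := hs

variable {V : Type*} [NormedAddCommGroup V] [NormedSpace ℂ V] {p : V}

theorem exists_line_not_eventually_eq_zero {f : V → ℂ} (hf : AnalyticAt ℂ f p)
    (hf0 : ¬ ∀ᶠ x in 𝓝 p, f x = 0) : ∃ v : V, ¬ ∀ᶠ z in 𝓝 (0 : ℂ), f (p + z • v) = 0 := by
  obtain ⟨r, hr, hball⟩ := Metric.eventually_nhds_iff_ball.1 hf.eventually_analyticAt
  obtain ⟨x, hx, hxb⟩ := ((not_eventually.1 hf0).and_eventually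
    (Metric.ball_mem_nhds p hr)).exists
  refine ⟨x - p, fun h => hx ?_⟩
  let Ω : Set ℂ := (fun z : ℂ => z • (x - p)) ⁻¹' Metric.ball 0 r
  have hΩ : IsPreconnected Ω := ((convex_ball (0 : V) r).is_linear_preimage
    ⟨fun y z => add_smul y z _, fun c z => smul_assoc c z _⟩).isPreconnected
  have han : AnalyticOnNhd ℂ (fun z => f (p + z • (x - p))) Ω := fun z hz =>
    (hball _ (by simpa [Ω] using hz)).fun_comp (by fun_prop)
  have heq := han.eqOn_zero_of_preconnected_of_eventuallyEq_zero hΩ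
    (z₀ := 0) (by simp [Ω, hr]) h (x := 1) (by simpa [Ω, dist_eq_norm] using hxb)
  simpa using heq

lemma exists_germRestrict_line_ne_zero {a : HolGerm p} (ha : a ≠ 0) (hap : germEval p a = 0) :
    ∃ v : V, v ≠ 0 ∧ germRestrict p (.toSpanSingleton ℂ v) a ≠ 0 := by
  obtain ⟨f, hf, rfl⟩ := exists_germAt_eq a
  rw [← germAt_zero, Ne, germAt_eq_germAt_iff hf analyticAt_const] at ha
  rw [germEval_germAt hf] at hap
  obtain ⟨v, hv⟩ := exists_line_not_eventually_eq_zero hf ha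
  refine ⟨v, fun hv0 => hv (by simp [hv0, hap]), ?_⟩
  rwa [germRestrict_germAt _ hf, ← germAt_zero, Ne, germAt_eq_germAt_iff _ analyticAt_const]
  exact AnalyticAt.fun_comp (by simpa using hf)
    (analyticAt_const.fun_add ((ContinuousLinearMap.toSpanSingleton ℂ v).analyticAt 0))

lemma map_linGerm_eq_zero_of_mem_span {C : Type*} [CommRing C] {φ : HolGerm p →+* C}
    {s : Set (V →L[ℂ] ℂ)} (hs : ∀ μ ∈ s, φ (linGerm p μ) = 0) {μ : V →L[ℂ] ℂ}
    (hμ : μ ∈ Submodule.span ℂ s) : φ (linGerm p μ) = 0 := by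
  induction hμ using Submodule.span_induction with
  | mem μ hμ => exact hs μ hμ
  | zero => simp
  | add μ ν _ _ hμ hν => rw [map_add, map_add, hμ, hν, add_zero]
  | smul c μ _ hμ => rw [map_smul, Algebra.smul_def, map_mul, hμ, mul_zero]

lemma exists_finset_span_eq {K E : Type*} [Field K] [AddCommGroup E] [Module K E]
    (W : Submodule K E) [FiniteDimensional K W] :
    ∃ s : Finset E, s.card = Module.finrank K W ∧ Submodule.span K (s : Set E) = W := by
  have hfg : W.FG := (Submodule.fg_iff_finiteDimensional W).2 ‹_›
  obtain ⟨s, hs, hspan⟩ := hfg.exists_span_finset_card_eq_spanFinrank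
  exact ⟨s, by rw [hs, ← W.spanFinrank_top, Module.finrank_eq_spanFinrank_of_free], hspan⟩

variable [FiniteDimensional ℂ V]

lemma finrank_clm_complex : Module.finrank ℂ (V →L[ℂ] ℂ) = Module.finrank ℂ V :=
  LinearMap.toContinuousLinearMap.finrank_eq.symm.trans Subspace.dual_finrank_eq

lemma ringKrullDim_add_one_le_one_of_line {C : Type*} [CommRing C] {φ : HolGerm p →+* C}
    (hφ : Function.Surjective φ) {v : V} (hv : v ≠ 0)
    (hlin : ∀ μ : V →L[ℂ] ℂ, μ v = 0 → φ (linGerm p μ) = 0) {a : HolGerm p} (ha : φ a = 0)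
    (hav : germRestrict p (.toSpanSingleton ℂ v) a ≠ 0) : ringKrullDim C + 1 ≤ 1 := by
  obtain ⟨ℓ, hℓ⟩ := SeparatingDual.exists_eq_one (R := ℂ) hv
  have hretract (b : HolGerm p) :
      φ (germExtend p ℓ (germRestrict p (.toSpanSingleton ℂ v) b)) = φ b := by
    have h := sub_germExtend_germRestrict_mem (p := p) (L := .toSpanSingleton ℂ v) (R := ℓ)
      (fun z => by simp [hℓ]) (J := RingHom.ker φ)
      (fun μ hμ => hlin μ (by simpa using DFunLike.congr_fun hμ 1)) b
    rw [RingHom.mem_ker, map_sub, sub_eq_zero] at h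
    exact h.symm
  have hsurj : Function.Surjective (φ.comp (germExtend p ℓ)) := fun c => by
    obtain ⟨b, rfl⟩ := hφ c
    exact ⟨_, hretract b⟩
  have hdim := ringKrullDim_succ_le_of_surjective _ hsurj (mem_nonZeroDivisors_of_ne_zero hav)
    ((hretract a).trans ha)
  rwa [IsDiscreteValuationRing.ringKrullDim_eq_one (HolGerm (0 : ℂ))] at hdim

lemma exists_finset_mem_span_iff_apply_eq_zero {v : V} (hv : v ≠ 0) :
    ∃ s : Finset (V →L[ℂ] ℂ), s.card + 1 = Module.finrank ℂ V ∧
      ∀ μ, μ ∈ Submodule.span ℂ (s : Set (V →L[ℂ] ℂ)) ↔ μ v = 0 := by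
  let ev : Module.Dual ℂ (V →L[ℂ] ℂ) := ContinuousLinearMap.apply ℂ ℂ v
  have hev : ev ≠ 0 := fun h => by
    obtain ⟨ℓ, hℓ⟩ := SeparatingDual.exists_eq_one (R := ℂ) hv
    simpa [ev, hℓ] using LinearMap.congr_fun h ℓ
  obtain ⟨s, hs, hspan⟩ := exists_finset_span_eq (LinearMap.ker ev)
  exact ⟨s, by rw [hs, Module.Dual.finrank_ker_add_one_of_ne_zero hev, finrank_clm_complex],
    fun μ => by rw [hspan]; rfl⟩

theorem ringKrullDim_add_one_le_of_surjective {B : Type*} [CommRing B] [IsNoetherianRing B]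
    {φ : HolGerm p →+* B} (hφ : Function.Surjective φ) {a : HolGerm p} (ha : a ≠ 0)
    (hφa : φ a = 0) : ringKrullDim B + 1 ≤ Module.finrank ℂ V := by
  classical
  rcases subsingleton_or_nontrivial B with _ | _
  · simp [ringKrullDim_eq_bot_of_subsingleton]
  have : IsLocalRing B := .of_surjective' φ hφ
  have : IsLocalHom φ := .of_surjective φ hφ
  have hnonunit {b : HolGerm p} : ¬ IsUnit (φ b) ↔ germEval p b = 0 := by
    rw [isUnit_map_iff, isUnit_iff_germEval_ne_zero, not_not]
  -- `a` does not vanish on some line `p + ℂ v`, and the `finrank V - 1` linear equations of this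
  -- line cut `B` down to dimension `0`; each of them lowers the dimension by at most one.
  obtain ⟨v, hv, hav⟩ := exists_germRestrict_line_ne_zero ha (hnonunit.1 (by simp [hφa]))
  obtain ⟨s, hcard, hspan⟩ := exists_finset_mem_span_iff_apply_eq_zero hv
  let T : Finset B := s.image fun μ => φ (linGerm p μ)
  have hT : (T : Set B) ⊆ Ring.jacobson B := by
    rw [IsLocalRing.ringJacobson_eq_maximalIdeal]
    simp only [T, Finset.coe_image, Set.image_subset_iff]
    exact fun μ _ => (IsLocalRing.mem_maximalIdeal _).2 (hnonunit.2 (germEval_linGerm μ))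
  have hcut : ringKrullDim (B ⧸ Ideal.span (T : Set B)) + 1 ≤ 1 :=
    ringKrullDim_add_one_le_one_of_line (Ideal.Quotient.mk_surjective.comp hφ) hv
      (fun μ hμ => map_linGerm_eq_zero_of_mem_span
        (φ := (Ideal.Quotient.mk (Ideal.span (T : Set B))).comp φ)
        (fun ν hν => Ideal.Quotient.eq_zero_iff_mem.2
          (Ideal.subset_span (Finset.mem_image_of_mem _ hν))) ((hspan μ).2 hμ))
      (by simp [hφa]) hav
  calc ringKrullDim B + 1 ≤ ringKrullDim (B ⧸ Ideal.span (T : Set B)) + T.card + 1 := by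
        gcongr; exact ringKrullDim_le_ringKrullDim_quotient_add_card T hT
    _ = ringKrullDim (B ⧸ Ideal.span (T : Set B)) + 1 + T.card := add_right_comm _ _ _
    _ ≤ 1 + T.card := by gcongr
    _ ≤ Module.finrank ℂ V := by
        have : T.card ≤ s.card := Finset.card_image_le
        norm_cast
        omega

theorem not_isRegularLocalRing_of_surjective {B : Type*} [CommRing B] {q : HolGerm p →+* B}
    (hq : Function.Surjective q) {a : HolGerm p} (ha : a ≠ 0) (hqa : q a = 0)
    {φ : B →+* TrivSqZeroExt ℂ (V →L[ℂ] ℂ)} (hφ : Function.Surjective φ) :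
    ¬ IsRegularLocalRing B := fun _ => by
  have hker : RingHom.ker ((TrivSqZeroExt.fstHom ℂ ℂ (V →L[ℂ] ℂ)).toRingHom.comp φ) =
      IsLocalRing.maximalIdeal B :=
    IsLocalRing.ker_eq_maximalIdeal _ (TrivSqZeroExt.fst_surjective.comp hφ)
  have hle := finrank_le_spanFinrank_ker_fst hφ (IsNoetherian.noetherian _)
  have hdim := ringKrullDim_add_one_le_of_surjective hq ha hqa
  rw [← IsRegularLocalRing.spanFinrank_maximalIdeal] at hdim
  rw [hker, finrank_clm_complex] at hle
  norm_cast at hdim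
  omega

theorem not_isRegularLocalRing_quotient {I : Ideal (HolGerm p)} (hI : I ≠ ⊥)
    (hjet : I ≤ RingHom.ker (germJet p)) : ¬ IsRegularLocalRing (HolGerm p ⧸ I) := by
  obtain ⟨a, haI, ha⟩ := Submodule.exists_mem_ne_zero_of_ne_bot hI
  exact not_isRegularLocalRing_of_surjective Ideal.Quotient.mk_surjective ha
    (Ideal.Quotient.eq_zero_iff_mem.2 haI)
    (Ideal.Quotient.lift_surjective_of_surjective I hjet (germJet_surjective p))

end NonRegular

section Minors

lemma exists_orderEmb_linearIndependent {K E : Type*} [Field K] [AddCommGroup E] [Module K E]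
    {m r : ℕ} (v : Fin m → E)
    (hr : r ≤ Module.finrank K (Submodule.span K (Set.range v))) :
    ∃ R : Fin r ↪o Fin m, LinearIndependent K (v ∘ R) := by
  classical
  obtain ⟨κ, a, ha, hspan, hli⟩ := exists_linearIndependent' K v
  have := Fintype.ofInjective a ha
  let s : Finset (Fin m) := Finset.univ.image a
  have hs : s.card = Module.finrank K (Submodule.span K (Set.range v)) := by
    rw [← hspan, finrank_span_eq_card hli, Finset.card_image_of_injective _ ha, Finset.card_univ]
  obtain ⟨s', hs', hcard⟩ := Finset.exists_subset_card_eq (hr.trans hs.ge)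
  let R := s'.orderEmbOfFin hcard
  have hR (i) : ∃ k, a k = R i := by simpa [s] using hs' (s'.orderEmbOfFin_mem hcard i)
  choose k hk using hR
  have hvk : v ∘ R = (v ∘ a) ∘ k := funext fun i => by simp [hk]
  exact ⟨R, hvk ▸ hli.comp k fun i j hij => R.injective (by rw [← hk, ← hk, hij])⟩

variable {K : Type*} [Field K]

lemma exists_minor_ne_zero {m n r : ℕ} (A : Matrix (Fin m) (Fin n) K) (hr : r ≤ A.rank) :
    ∃ (R : Fin r ↪o Fin m) (C : Fin r ↪o Fin n), (A.submatrix R C).det ≠ 0 := by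
  rw [A.rank_eq_finrank_span_row] at hr
  obtain ⟨R, hR⟩ := exists_orderEmb_linearIndependent A.row hr
  have hrows : (A.submatrix R id).rank = r := by
    simpa using LinearIndependent.rank_matrix (M := A.submatrix R id) hR
  rw [Matrix.rank_eq_finrank_span_cols] at hrows
  obtain ⟨C, hC⟩ := exists_orderEmb_linearIndependent (A.submatrix R id).col hrows.ge
  have hunit : IsUnit (A.submatrix R C) := Matrix.linearIndependent_cols_iff_isUnit.1 hC
  exact ⟨R, C, ((Matrix.isUnit_iff_isUnit_det _).1 hunit).ne_zero⟩

lemma card_le_rank_of_minor_ne_zero {ι μ ν : Type*} [Fintype ι] [DecidableEq ι] [Fintype ν]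
    {A : Matrix μ ν K} {R : ι → μ} {C : ι → ν} (h : (A.submatrix R C).det ≠ 0) :
    Fintype.card ι ≤ A.rank := by
  rw [← Matrix.rank_of_det_ne_zero h]
  exact Matrix.rank_submatrix_le _ _ _

lemma rank_lt_iff_minors_eq_zero {m n r : ℕ} {A : Matrix (Fin m) (Fin n) K} :
    A.rank < r ↔ ∀ (R : Fin r ↪o Fin m) (C : Fin r ↪o Fin n), (A.submatrix R C).det = 0 := by
  refine ⟨fun h R C => ?_, fun h => ?_⟩
  · by_contra hne
    have := card_le_rank_of_minor_ne_zero hne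
    simp only [Fintype.card_fin] at this
    omega
  · by_contra! hle
    obtain ⟨R, C, hne⟩ := exists_minor_ne_zero A hle
    exact hne (h R C)

lemma det_updateRow_eq_zero {ι : Type*} [Fintype ι] [DecidableEq ι] {B : Matrix ι ι K}
    (hB : B.rank + 1 < Fintype.card ι) (i : ι) (v : ι → K) : (B.updateRow i v).det = 0 := by
  by_contra hne
  have hrows : LinearIndependent K (B.updateRow i v).row :=
    Matrix.linearIndependent_rows_iff_isUnit.2 ((Matrix.isUnit_iff_isUnit_det _).2 (Ne.isUnit hne))
  have hother : (B.updateRow i v).submatrix (Subtype.val : {j // j ≠ i} → ι) id =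
      B.submatrix Subtype.val id := by
    ext j k
    simp [j.2]
  have hrank := LinearIndependent.rank_matrix
    (M := (B.updateRow i v).submatrix (Subtype.val : {j // j ≠ i} → ι) id)
    (hrows.comp _ Subtype.val_injective)
  have hle := Matrix.rank_submatrix_le B (Subtype.val : {j // j ≠ i} → ι) id
  rw [hother] at hrank
  rw [hrank, Fintype.card_subtype_compl, Fintype.card_subtype_eq] at hle
  omega

end Minors

section DeterminantalPoints

variable {V : Type*} [NormedAddCommGroup V] [NormedSpace ℂ V] {p : V} {N m n t : ℕ}

lemma analyticAt_det {ι : Type*} [Fintype ι] [DecidableEq ι] {B : V → Matrix ι ι ℂ}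
    (hB : ∀ i j, AnalyticAt ℂ (fun x => B x i j) p) : AnalyticAt ℂ (fun x => (B x).det) p := by
  simp_rw [Matrix.det_apply']
  exact Finset.analyticAt_fun_sum _ fun σ _ => analyticAt_const.fun_mul
    (Finset.analyticAt_fun_prod _ fun i _ => hB _ _)

lemma fderiv_det_eq_zero {ι : Type*} [Fintype ι] [DecidableEq ι] {B : V → Matrix ι ι ℂ}
    (hB : ∀ i j, DifferentiableAt ℂ (fun x => B x i j) p)
    (hr : (B p).rank + 1 < Fintype.card ι) : fderiv ℂ (fun x => (B x).det) p = 0 := by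
  let D : ContinuousMultilinearMap ℂ (fun _ : ι => ι → ℂ) ℂ :=
    { toMultilinearMap := (Matrix.detRowAlternating (n := ι) (R := ℂ)).toMultilinearMap
      cont := Continuous.matrix_det (A := fun M : ι → ι → ℂ => Matrix.of M) continuous_id }
  let rows : V → ι → ι → ℂ := fun x i j => B x i j
  have hrows : DifferentiableAt ℂ rows p :=
    differentiableAt_pi.2 fun i => differentiableAt_pi.2 fun j => hB i j
  have hD : D.linearDeriv (rows p) = 0 := ContinuousLinearMap.ext fun y => by
    rw [ContinuousMultilinearMap.linearDeriv_apply]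
    exact Finset.sum_eq_zero fun i _ => det_updateRow_eq_zero hr i (y i)
  have hderiv : HasFDerivAt (fun x => D (rows x)) (D.linearDeriv (rows p) ∘L fderiv ℂ rows p) p :=
    (D.hasFDerivAt (rows p)).comp p hrows.hasFDerivAt
  rw [hD, ContinuousLinearMap.zero_comp] at hderiv
  exact hderiv.fderiv

lemma analyticAt_entry {F : V → Mat m n} (hF : AnalyticAt ℂ F p) (i : Fin m) (j : Fin n) :
    AnalyticAt ℂ (fun x => F x i j) p :=
  analyticAt_pi_iff.1 (analyticAt_pi_iff.1 hF i) j

lemma analyticAt_minor {ι : Type*} [Fintype ι] [DecidableEq ι] {F : V → Mat m n}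
    (hF : AnalyticAt ℂ F p) (R : ι → Fin m) (C : ι → Fin n) :
    AnalyticAt ℂ (fun x => ((Matrix.of (F x)).submatrix R C).det) p :=
  analyticAt_det fun _ _ => analyticAt_entry hF _ _

variable {F : Cn N → Mat m n} {p : Cn N}

lemma minorIdeal_le_ker_germJet (hF : AnalyticAt ℂ F p) (hp : (Matrix.of (F p)).rank + 1 < t) :
    minorIdeal t F p ≤ RingHom.ker (germJet p) := by
  refine Ideal.span_le.2 ?_
  rintro _ ⟨R, C, rfl⟩
  have hrank := Matrix.rank_submatrix_le (Matrix.of (F p)) R C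
  have hvalue : ((Matrix.of (F p)).submatrix R C).det = 0 :=
    rank_lt_iff_minors_eq_zero.1 (by omega) R C
  have hderiv : fderiv ℂ (fun x => ((Matrix.of (F x)).submatrix R C).det) p = 0 :=
    fderiv_det_eq_zero (fun _ _ => (analyticAt_entry hF _ _).differentiableAt)
      (by rw [Fintype.card_fin]; omega)
  rw [SetLike.mem_coe, RingHom.mem_ker, germJet_germAt (analyticAt_minor hF R C), hvalue, hderiv,
    TrivSqZeroExt.inl_zero, TrivSqZeroExt.inr_zero, add_zero]

theorem isSingularAt_of_mem_genericDet (hF : AnalyticAt ℂ F p) (hI : minorIdeal t F p ≠ ⊥)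
    (hp : F p ∈ genericDet m n (t - 1)) : IsSingularAt t F p := by
  have hrank : (Matrix.of (F p)).rank < t - 1 := hp
  exact ⟨show (Matrix.of (F p)).rank < t by omega,
    not_isRegularLocalRing_quotient hI (minorIdeal_le_ker_germJet hF (by omega))⟩

theorem IsDeterminantal.minorIdeal_ne_bot (hX : IsDeterminantal t F) : minorIdeal t F 0 ≠ ⊥ :=
    fun hbot => by
  have hdim : ringKrullDim (detLocalRing t F 0) = ringKrullDim (HolGerm (0 : Cn N)) :=
    ringKrullDim_eq_of_ringEquiv ((Ideal.quotEquivOfEq hbot).trans (RingEquiv.quotientBot _))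
  have hN := finrank_le_ringKrullDim_holGerm (0 : Cn N)
  rw [Module.finrank_fin_fun, ← hdim] at hN
  have hle : ((N + (m - t + 1) * (n - t + 1) : ℕ) : WithBot ℕ∞) ≤ (N : ℕ) := by
    rw [← hX.codim, Nat.cast_add]
    gcongr
  have hpos : 0 < (m - t + 1) * (n - t + 1) := by positivity
  norm_cast at hle
  omega

lemma minorIdeal_ne_bot_iff (hF : AnalyticAt ℂ F p) : minorIdeal t F p ≠ ⊥ ↔
    ∃ (R : Fin t ↪o Fin m) (C : Fin t ↪o Fin n),
      ¬ ∀ᶠ x in 𝓝 p, ((Matrix.of (F x)).submatrix R C).det = 0 := by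
  rw [Ne, minorIdeal, Ideal.span_eq_bot, not_iff_comm]
  push Not
  refine ⟨fun h g => ?_, fun h R C => ?_⟩
  · rintro ⟨R, C, rfl⟩
    rw [← germAt_zero, germAt_eq_germAt_iff (analyticAt_minor hF R C) analyticAt_const]
    exact h R C
  · refine (germAt_eq_germAt_iff (analyticAt_minor hF R C) analyticAt_const).1 ?_
    rw [h _ ⟨R, C, rfl⟩, germAt_zero]

end DeterminantalPoints

section Families

variable {P V : Type*} [NormedAddCommGroup P] [NormedSpace ℂ P] [NormedAddCommGroup V]
  [NormedSpace ℂ V] {N m n t τ : ℕ}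

theorem eventually_not_eventually_eq_zero {f : P → V → ℂ} {s : P} {p : V}
    (hf : AnalyticAt ℂ (fun y : P × V => f y.1 y.2) (s, p)) (hf0 : ¬ ∀ᶠ x in 𝓝 p, f s x = 0) :
    ∀ᶠ y in 𝓝 (s, p), ¬ ∀ᶠ x in 𝓝 y.2, f y.1 x = 0 := by
  obtain ⟨r, hr, hball⟩ := Metric.eventually_nhds_iff_ball.1 hf.eventually_analyticAt
  simp only [← ball_prod_same, Set.mem_prod, and_imp, Prod.forall] at hball
  obtain ⟨x₀, hx₀, hx₀r⟩ := ((not_eventually.1 hf0).and_eventually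
    (Metric.ball_mem_nhds p hr)).exists
  have hs : ∀ᶠ s' in 𝓝 s, f s' x₀ ≠ 0 :=
    (hball s x₀ (Metric.mem_ball_self hr) hx₀r).curry_left.continuousAt.eventually_ne hx₀
  filter_upwards [prod_mem_nhds (hs.and (Metric.ball_mem_nhds s hr)) (Metric.ball_mem_nhds p hr)]
  rintro ⟨s', x⟩ ⟨⟨hs'₀, hs'⟩, hx⟩ hzero
  have han : AnalyticOnNhd ℂ (f s') (Metric.ball p r) := fun y hy => (hball s' y hs' hy).curry_right
  exact hs'₀ (han.eqOn_zero_of_preconnected_of_eventuallyEq_zero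
    (convex_ball _ _).isPreconnected hx hzero hx₀r)

theorem eventually_minorIdeal_ne_bot {𝓕 : P → Cn N → Mat m n} {y₀ : P × Cn N}
    (h𝓕 : AnalyticAt ℂ (fun y : P × Cn N => 𝓕 y.1 y.2) y₀)
    (hne : minorIdeal t (𝓕 y₀.1) y₀.2 ≠ ⊥) :
    ∀ᶠ y in 𝓝 y₀, minorIdeal t (𝓕 y.1) y.2 ≠ ⊥ := by
  obtain ⟨R, C, hRC⟩ := (minorIdeal_ne_bot_iff h𝓕.curry_right).1 hne
  filter_upwards [h𝓕.eventually_analyticAt,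
    eventually_not_eventually_eq_zero
      (f := fun s x => ((Matrix.of (𝓕 s x)).submatrix R C).det)
      (analyticAt_minor h𝓕 R C) hRC] with y hy hyRC
  exact (minorIdeal_ne_bot_iff hy.curry_right).2 ⟨R, C, hyRC⟩

variable {F : Cn N → Mat m n} {G : Fin τ → Cn N → Mat m n}

lemma versalFamily_zero : versalFamily F G 0 = F :=
  funext fun x => by simp [versalFamily]

lemma analyticAt_versalFamily {s : Cn τ} {p : Cn N} (hF : AnalyticAt ℂ F p)
    (hG : ∀ i, AnalyticAt ℂ (G i) p) :
    AnalyticAt ℂ (fun y : Cn τ × Cn N => versalFamily F G y.1 y.2) (s, p) := by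
  have hsnd {f : Cn N → Mat m n} (hf : AnalyticAt ℂ f p) :
      AnalyticAt ℂ (fun y : Cn τ × Cn N => f y.2) (s, p) := hf.fun_comp analyticAt_snd
  exact (hsnd hF).fun_add (Finset.analyticAt_fun_sum _ fun i _ =>
    (analyticAt_pi_iff.1 analyticAt_fst i).fun_smul (hsnd (hG i)))

end Families

section Skeleton

variable {ι μ ν K : Type*} [Fintype ι] [DecidableEq ι] [Field K]

/-- The skeleton (or CUR) approximation of `A` along the rows `R` and the columns `C`. Where the
minor `A[R, C]` does not vanish, `A ↦ skeleton R C A` retracts the matrices onto those of rank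
`card ι`. -/
def skeleton (R : ι → μ) (C : ι → ν) (A : Matrix μ ν K) : Matrix μ ν K :=
  A.submatrix id C * (A.submatrix R C)⁻¹ * A.submatrix R id

variable {R : ι → μ} {C : ι → ν} {A : Matrix μ ν K}

lemma det_submatrix_sumElim (hA : (A.submatrix R C).det ≠ 0) (i : μ) (j : ν) :
    (A.submatrix (Sum.elim R fun _ : Unit => i) (Sum.elim C fun _ : Unit => j)).det =
      (A i j - skeleton R C A i j) * (A.submatrix R C).det := by
  let _ : Invertible (A.submatrix R C) := Matrix.invertibleOfIsUnitDet _ hA.isUnit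
  have hblocks : A.submatrix (Sum.elim R fun _ : Unit => i) (Sum.elim C fun _ : Unit => j) =
      Matrix.fromBlocks (A.submatrix R C) (A.submatrix R fun _ => j)
        (A.submatrix (fun _ => i) C) (A.submatrix (fun _ => i) fun _ => j) := by
    ext (k | k) (l | l) <;> rfl
  rw [hblocks, Matrix.det_fromBlocks₁₁, Matrix.det_unique (n := Unit),
    Matrix.invOf_eq_nonsing_inv, mul_comm]
  rfl

variable [Fintype ν]

lemma skeleton_eq_self (hA : (A.submatrix R C).det ≠ 0) (hr : A.rank ≤ Fintype.card ι) :
    skeleton R C A = A := by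
  ext i j
  by_contra hij
  have hminor : (A.submatrix (Sum.elim R fun _ : Unit => i)
      (Sum.elim C fun _ : Unit => j)).det ≠ 0 := by
    rw [det_submatrix_sumElim hA]
    exact mul_ne_zero (sub_ne_zero.2 (Ne.symm hij)) hA
  have hcard := card_le_rank_of_minor_ne_zero hminor
  rw [Fintype.card_sum, Fintype.card_unit] at hcard
  omega

lemma rank_skeleton (hA : (A.submatrix R C).det ≠ 0) :
    (skeleton R C A).rank = Fintype.card ι := by
  refine le_antisymm ((Matrix.rank_mul_le_right _ _).trans ?_)
    (card_le_rank_of_minor_ne_zero (R := R) (C := C) ?_)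
  · exact Matrix.rank_le_card_height (A.submatrix R id)
  · have hRC : (skeleton R C A).submatrix R C =
        A.submatrix R C * (A.submatrix R C)⁻¹ * A.submatrix R C := rfl
    rwa [hRC, Matrix.mul_nonsing_inv _ hA.isUnit, Matrix.one_mul]

end Skeleton

section RankLocus

variable {N m n t : ℕ}

lemma exists_orderEmb_comp_equiv {ι : Type*} [Fintype ι] {f : ι → Fin m}
    (hf : Function.Injective f) (hι : Fintype.card ι = t) :
    ∃ (R : Fin t ↪o Fin m) (σ : ι ≃ Fin t), f = R ∘ σ := by
  let e : ι ≃ Fin t := Fintype.equivFinOfCardEq hι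
  let σ := Tuple.sort (f ∘ e.symm)
  have hmono : StrictMono ((f ∘ e.symm) ∘ σ) := (Tuple.monotone_sort _).strictMono_of_injective
    ((hf.comp e.symm.injective).comp σ.injective)
  refine ⟨OrderEmbedding.ofStrictMono _ hmono, e.trans σ.symm, ?_⟩
  funext i
  simp

lemma germAt_minor_mem_minorIdeal {ι : Type*} [Fintype ι] [DecidableEq ι]
    (hι : Fintype.card ι = t) {F : Cn N → Mat m n} {p : Cn N} (hF : AnalyticAt ℂ F p)
    (f : ι → Fin m) (g : ι → Fin n) :
    germAt (fun x => ((Matrix.of (F x)).submatrix f g).det) p ∈ minorIdeal t F p := by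
  have hzero (h : ∀ A : Matrix (Fin m) (Fin n) ℂ, (A.submatrix f g).det = 0) :
      germAt (fun x => ((Matrix.of (F x)).submatrix f g).det) p ∈ minorIdeal t F p := by
    simp_rw [h, germAt_zero]
    exact Ideal.zero_mem _
  by_cases hf : Function.Injective f; swap
  · obtain ⟨i, j, hij, hne⟩ := Function.not_injective_iff.1 hf
    exact hzero fun A => Matrix.det_zero_of_row_eq hne (by ext k; simp [hij])
  by_cases hg : Function.Injective g; swap
  · obtain ⟨i, j, hij, hne⟩ := Function.not_injective_iff.1 hg
    exact hzero fun A => Matrix.det_zero_of_column_eq hne fun k => by simp [hij]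
  obtain ⟨R, σ, rfl⟩ := exists_orderEmb_comp_equiv hf hι
  obtain ⟨C, θ, rfl⟩ := exists_orderEmb_comp_equiv hg hι
  have hsign (A : Matrix (Fin m) (Fin n) ℂ) : (A.submatrix (R ∘ σ) (C ∘ θ)).det =
      Equiv.Perm.sign (θ.symm.trans σ) * (A.submatrix R C).det :=
    Matrix.det_reindex σ.symm θ.symm (A.submatrix R C)
  simp_rw [hsign]
  rw [germAt_mul analyticAt_const (analyticAt_minor hF R C)]
  exact Ideal.mul_mem_left _ _ (Ideal.subset_span ⟨R, C, rfl⟩)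

variable {ι : Type*} [Fintype ι] [DecidableEq ι] {R : ι → Fin m} {C : ι → Fin n}
  {F : Cn N → Mat m n} {p : Cn N}

lemma eventually_sub_skeleton_eq (hF : AnalyticAt ℂ F p)
    (hRC : ((Matrix.of (F p)).submatrix R C).det ≠ 0) (i : Fin m) (j : Fin n) :
    (fun x => F x i j - skeleton R C (Matrix.of (F x)) i j) =ᶠ[𝓝 p] fun x =>
      ((Matrix.of (F x)).submatrix (Sum.elim R fun _ : Unit => i)
        (Sum.elim C fun _ : Unit => j)).det * (((Matrix.of (F x)).submatrix R C).det)⁻¹ := by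
  filter_upwards [(analyticAt_minor hF R C).continuousAt.eventually_ne hRC] with x hx
  rw [det_submatrix_sumElim hx, mul_inv_cancel_right₀ hx, Matrix.of_apply]

lemma analyticAt_skeleton (hF : AnalyticAt ℂ F p)
    (hRC : ((Matrix.of (F p)).submatrix R C).det ≠ 0) :
    AnalyticAt ℂ (fun x => Matrix.of.symm (skeleton R C (Matrix.of (F x)))) p := by
  refine analyticAt_pi_iff.2 fun i => analyticAt_pi_iff.2 fun j => ?_
  have hsub := ((analyticAt_minor hF _ _).fun_mul ((analyticAt_minor hF R C).fun_inv hRC)).congr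
    (eventually_sub_skeleton_eq hF hRC i j).symm
  simpa using (analyticAt_entry hF i j).fun_sub hsub

lemma germAt_sub_skeleton_mem (hF : AnalyticAt ℂ F p) (hι : Fintype.card ι + 1 = t)
    (hRC : ((Matrix.of (F p)).submatrix R C).det ≠ 0) (i : Fin m) (j : Fin n) :
    germAt (fun x => F x i j - skeleton R C (Matrix.of (F x)) i j) p ∈ minorIdeal t F p := by
  rw [germAt_congr (eventually_sub_skeleton_eq hF hRC i j),
    germAt_mul (analyticAt_minor hF _ _) ((analyticAt_minor hF R C).fun_inv hRC)]
  exact Ideal.mul_mem_right _ _ (germAt_minor_mem_minorIdeal (by simpa using hι) hF _ _)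

theorem germAt_comp_mem_minorIdeal (hF : AnalyticAt ℂ F p)
    (hr : (Matrix.of (F p)).rank + 1 = t) {g : Mat m n → ℂ} (hg : AnalyticAt ℂ g (F p))
    (hg0 : ∀ᶠ A in 𝓝 (F p), (Matrix.of A).rank + 1 = t → g A = 0) :
    germAt (fun x => g (F x)) p ∈ minorIdeal t F p := by
  obtain ⟨R, C, hRC⟩ := exists_minor_ne_zero (Matrix.of (F p)) le_rfl
  let retract (x : Cn N) : Mat m n := Matrix.of.symm (skeleton R C (Matrix.of (F x)))
  have hretract : AnalyticAt ℂ retract p := analyticAt_skeleton hF hRC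
  have hp : retract p = F p := skeleton_eq_self hRC (Fintype.card_fin _).ge
  have hcongr : germAt (fun x => g (F x)) p - germAt (fun x => g (retract x)) p ∈
      minorIdeal t F p := by
    refine germAt_comp_sub_mem (Pi.basis fun _ => Pi.basisFun ℂ (Fin n)) hg hF hretract rfl hp ?_
    rintro ⟨i, j⟩
    simpa [retract] using germAt_sub_skeleton_mem hF (by simpa using hr) hRC i j
  have hzero : germAt (fun x => g (retract x)) p = 0 := by
    rw [← germAt_zero]
    refine germAt_congr ?_
    have hlim : Tendsto retract (𝓝 p) (𝓝 (F p)) := by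
      simpa only [hp] using hretract.continuousAt.tendsto
    filter_upwards [hlim.eventually hg0,
      (analyticAt_minor hF R C).continuousAt.eventually_ne hRC] with x hx hxRC
    refine hx ?_
    rw [← hr, Equiv.apply_symm_apply, rank_skeleton hxRC, Fintype.card_fin]
  rwa [hzero, sub_zero] at hcongr

end RankLocus

section KernelCoordinate

variable {𝕜 E F : Type*} [RCLike 𝕜] [NormedAddCommGroup E] [InnerProductSpace 𝕜 E]
  [NormedAddCommGroup F] [NormedSpace 𝕜 F] {K : Submodule 𝕜 E} (L : F →L[𝕜] Kᗮ) {T : E →L[𝕜] F}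

/-- If `L ∘ T` is invertible on `Kᗮ`, then `kerCoord L T : K → Kᗮ` is the only linear map whose
graph can be the kernel of `T`. -/
def kerCoord (T : E →L[𝕜] F) : K →L[𝕜] Kᗮ :=
  -(Ring.inverse (L ∘L T ∘L Kᗮ.subtypeL) ∘L (L ∘L T ∘L K.subtypeL))

lemma eq_kerCoord_apply (hT : IsUnit (L ∘L T ∘L Kᗮ.subtypeL)) {k : K} {w : Kᗮ}
    (h : T (k + w) = 0) : w = kerCoord L T k := by
  have hsolve : (L ∘L T ∘L Kᗮ.subtypeL) w = -(L ∘L T ∘L K.subtypeL) k := by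
    rw [eq_neg_iff_add_eq_zero, add_comm]
    simpa using congrArg L h
  have hinv : Ring.inverse (L ∘L T ∘L Kᗮ.subtypeL) ((L ∘L T ∘L Kᗮ.subtypeL) w) = w :=
    DFunLike.congr_fun (Ring.inverse_mul_cancel _ hT) w
  rw [← hinv, hsolve, map_neg]
  rfl

lemma analyticAt_kerCoord [CompleteSpace E] (hT : IsUnit (L ∘L T ∘L Kᗮ.subtypeL)) :
    AnalyticAt 𝕜 (kerCoord L) T := by
  obtain ⟨u, hu⟩ := hT
  have hcomp {X : Submodule 𝕜 E} :
      AnalyticAt 𝕜 (fun T : E →L[𝕜] F => L ∘L T ∘L X.subtypeL) T :=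
    ((ContinuousLinearMap.compL 𝕜 X F Kᗮ L) ∘L
      ((ContinuousLinearMap.compL 𝕜 X E F).flip X.subtypeL)).analyticAt T
  have hinv : AnalyticAt 𝕜 (fun T : E →L[𝕜] F => Ring.inverse (L ∘L T ∘L Kᗮ.subtypeL)) T :=
    AnalyticAt.fun_comp (g := Ring.inverse) (hu ▸ analyticAt_inverse u) hcomp
  exact (AnalyticAt.fun_comp (g := fun q : (Kᗮ →L[𝕜] Kᗮ) × (K →L[𝕜] Kᗮ) => q.1 ∘L q.2)
    ((ContinuousLinearMap.compL 𝕜 K Kᗮ Kᗮ).analyticAt_bilinear _) (hinv.prod hcomp)).fun_neg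

lemma eventually_isUnit_comp_subtypeL [CompleteSpace E] (hT : IsUnit (L ∘L T ∘L Kᗮ.subtypeL)) :
    ∀ᶠ T' in 𝓝 T, IsUnit (L ∘L T' ∘L Kᗮ.subtypeL) := by
  have hcont : Continuous fun T' : E →L[𝕜] F => L ∘L T' ∘L Kᗮ.subtypeL := by fun_prop
  exact (Units.isOpen.preimage hcont).mem_nhds hT

lemma exists_comp_subtypeL_eq_one [FiniteDimensional 𝕜 F] (hK : T.ker ≤ K) :
    ∃ L : F →L[𝕜] Kᗮ, L ∘L T ∘L Kᗮ.subtypeL = 1 := by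
  have hinj : LinearMap.ker (T ∘L Kᗮ.subtypeL).toLinearMap = ⊥ :=
    LinearMap.ker_eq_bot'.2 fun v hv =>
      Subtype.ext (inner_self_eq_zero.1 ((Submodule.mem_orthogonal _ _).1 v.2 _ (hK hv)))
  obtain ⟨L, hL⟩ := LinearMap.exists_leftInverse_of_injective _ hinj
  exact ⟨L.toContinuousLinearMap, ContinuousLinearMap.ext fun v => LinearMap.congr_fun hL v⟩

end KernelCoordinate

section KernelChart

variable {m n : ℕ}

/-- The action of matrices on Euclidean space, as a continuous linear map. -/
def matOp (m n : ℕ) :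
    Mat m n →L[ℂ] (EuclideanSpace ℂ (Fin n) →L[ℂ] EuclideanSpace ℂ (Fin m)) :=
  LinearMap.toContinuousLinearMap <| LinearMap.toContinuousLinearMap.toLinearMap ∘ₗ
    (Matrix.toLpLin 2 2).toLinearMap ∘ₗ (Matrix.ofLinearEquiv ℂ).toLinearMap

lemma mem_matKer {A : Mat m n} {v : EuclideanSpace ℂ (Fin n)} :
    v ∈ matKer A ↔ matOp m n A v = 0 := Iff.rfl

lemma rank_add_finrank_matKer (A : Mat m n) :
    (Matrix.of A).rank + Module.finrank ℂ (matKer A) = n := by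
  rw [Matrix.rank_eq_finrank_range_toLin (Matrix.of A) (PiLp.basisFun 2 ℂ (Fin m))
    (PiLp.basisFun 2 ℂ (Fin n)), ← Matrix.toLpLin_eq_toLin, matKer,
    LinearMap.finrank_range_add_finrank_ker, finrank_euclideanSpace_fin]

variable {K : Submodule ℂ (EuclideanSpace ℂ (Fin n))}

lemma add_apply_mem_chartPoint (φ : GrChart K) (k : K) :
    (k + φ k : EuclideanSpace ℂ (Fin n)) ∈ chartPoint K φ := ⟨k, rfl⟩

lemma chartPoint_zero : chartPoint K 0 = K := by
  ext v
  simp [chartPoint]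

lemma finrank_chartPoint_le (φ : GrChart K) :
    Module.finrank ℂ (chartPoint K φ) ≤ Module.finrank ℂ K :=
  LinearMap.finrank_range_le _

/-- `P` extends the map `B ↦ ker B`, defined on the matrices of the rank of `A`, to a holomorphic
map on a neighbourhood of `A`, in the chart of the Grassmannian around `ker A`. -/
structure IsKerChart (A : Mat m n) (P : Mat m n → GrChart (matKer A)) : Prop where
  analyticAt : AnalyticAt ℂ P A
  eventually_eq : ∀ᶠ B in 𝓝 A, ∀ φ, matKer B = chartPoint (matKer A) φ → φ = P B
  eventually_matKer_eq : ∀ᶠ B in 𝓝 A, (Matrix.of B).rank = (Matrix.of A).rank →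
    matKer B = chartPoint (matKer A) (P B)

lemma IsKerChart.apply_self {A : Mat m n} {P : Mat m n → GrChart (matKer A)}
    (hP : IsKerChart A P) : P A = 0 :=
  (hP.eventually_eq.self_of_nhds 0 chartPoint_zero.symm).symm

theorem exists_isKerChart (A : Mat m n) : ∃ P, IsKerChart A P := by
  obtain ⟨L, hL⟩ := exists_comp_subtypeL_eq_one (T := matOp m n A) (K := matKer A) le_rfl
  have hunit : IsUnit (L ∘L matOp m n A ∘L (matKer A)ᗮ.subtypeL) := hL ▸ isUnit_one
  have hnear := (matOp m n).continuous.continuousAt.eventually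
    (eventually_isUnit_comp_subtypeL L hunit)
  refine ⟨fun B => kerCoord L (matOp m n B),
    (analyticAt_kerCoord L hunit).fun_comp ((matOp m n).analyticAt A), ?_, ?_⟩
  · filter_upwards [hnear] with B hB φ hφ
    ext1 k
    have hk := add_apply_mem_chartPoint φ k
    rw [← hφ, mem_matKer] at hk
    exact eq_kerCoord_apply L hB hk
  · filter_upwards [hnear] with B hB hrank
    refine Submodule.eq_of_le_of_finrank_le (fun v hv => ?_) ?_
    · obtain ⟨k, hk, w, hw, rfl⟩ := (matKer A).exists_add_mem_mem_orthogonal v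
      have hkw := eq_kerCoord_apply L hB (k := ⟨k, hk⟩) (w := ⟨w, hw⟩) (mem_matKer.1 hv)
      simpa [← hkw] using add_apply_mem_chartPoint (kerCoord L (matOp m n B)) ⟨k, hk⟩
    · have hA := rank_add_finrank_matKer A
      have hB := rank_add_finrank_matKer B
      have hle := finrank_chartPoint_le (kerCoord L (matOp m n B))
      omega

end KernelChart

section TjurinaTransform

variable {N m n t : ℕ} {A : Mat m n} {P : Mat m n → GrChart (matKer A)}

lemma matOp_eq_zero_of_mem_tjurinaW {K : Submodule ℂ (EuclideanSpace ℂ (Fin n))}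
    {w : Mat m n × GrChart K} (hw : w ∈ tjurinaW m t K) (k : K) :
    matOp m n w.1 (k + w.2 k) = 0 := by
  have hclosed : IsClosed {w : Mat m n × GrChart K | matOp m n w.1 (k + w.2 k) = 0} :=
    isClosed_eq (by fun_prop) continuous_const
  refine closure_minimal ?_ hclosed hw
  rintro ⟨A, φ⟩ ⟨-, hker⟩
  refine mem_matKer.1 ?_
  rw [hker]
  exact add_apply_mem_chartPoint φ k

theorem isTjurinaPoint_iff {F : Cn N → Mat m n} {p : Cn N}
    (hr : (Matrix.of (F p)).rank + 1 = t) {K : Submodule ℂ (EuclideanSpace ℂ (Fin n))} :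
    IsTjurinaPoint t F p K ↔ K = matKer (F p) := by
  have hfin := rank_add_finrank_matKer (F p)
  constructor
  · rintro ⟨hK, -, hW⟩
    refine Submodule.eq_of_le_of_finrank_eq (fun k hk => mem_matKer.2 ?_) (by omega)
    simpa using matOp_eq_zero_of_mem_tjurinaW hW ⟨k, hk⟩
  · rintro rfl
    exact ⟨by omega, show (Matrix.of (F p)).rank < t by omega,
      subset_closure ⟨hr, chartPoint_zero.symm⟩⟩

theorem existsUnique_isTjurinaPoint {F : Cn N → Mat m n} {p : Cn N}
    (hr : (Matrix.of (F p)).rank + 1 = t) : ∃! K, IsTjurinaPoint t F p K :=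
  ⟨_, (isTjurinaPoint_iff hr).2 rfl, fun _ => (isTjurinaPoint_iff hr).1⟩

lemma IsKerChart.eventually_mem_tjurinaW (hP : IsKerChart A P)
    (hr : (Matrix.of A).rank + 1 = t) :
    ∀ᶠ B in 𝓝 A, (Matrix.of B).rank + 1 = t → (B, P B) ∈ tjurinaW m t (matKer A) := by
  filter_upwards [hP.eventually_matKer_eq] with B hB hrB
  exact subset_closure ⟨hrB, hB (by omega)⟩

lemma IsKerChart.eventually_snd_eq (hP : IsKerChart A P) :
    ∀ᶠ w in 𝓝 (A, 0), w ∈ tjurinaW m t (matKer A) → w.2 = P w.1 := by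
  have hfst : Tendsto Prod.fst (𝓝 (A, (0 : GrChart (matKer A)))) (𝓝 A) := continuous_fst.tendsto _
  filter_upwards [hfst.eventually hP.analyticAt.eventually_analyticAt,
    (hfst.eventually hP.eventually_eq).eventually_nhds] with w hw hnear hwW
  have hcont : ContinuousAt (fun z : Mat m n × GrChart (matKer A) => P z.1) w :=
    ContinuousAt.comp (g := P) hw.continuousAt continuousAt_fst
  by_contra hne
  obtain ⟨z, hzW, hzP, hz⟩ := ((mem_closure_iff_frequently.1 hwW).and_eventually
    (hnear.and ((continuousAt_snd.ne_iff_eventually_ne hcont).1 hne))).exists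
  exact hz (hzP _ hzW.2)

variable {F : Cn N → Mat m n} {p : Cn N} {P : Mat m n → GrChart (matKer (F p))}

/-- The restriction of germs on `ℂ^N × GrChart (ker F(p))` to the graph of the kernel map
`x ↦ ker F(x)`. -/
def IsKerChart.graphRestrict (hP : IsKerChart (F p) P) (hF : AnalyticAt ℂ F p) :
    HolGerm ((p, 0) : Cn N × GrChart (matKer (F p))) →+* HolGerm p :=
  germPullback (fun x => (x, P (F x))) (analyticAt_id.prod (hP.analyticAt.fun_comp hF))
    (Prod.ext rfl hP.apply_self)

lemma IsKerChart.graphRestrict_germAt (hP : IsKerChart (F p) P) (hF : AnalyticAt ℂ F p)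
    {f : Cn N × GrChart (matKer (F p)) → ℂ} (hf : AnalyticAt ℂ f (p, 0)) :
    hP.graphRestrict hF (germAt f (p, 0)) = germAt (fun x => f (x, P (F x))) p :=
  germPullback_germAt _ _ hf

/-- Germs on `ℂ^N` as germs on `ℂ^N × E` that do not depend on the second variable. -/
def germFst (E : Type*) [NormedAddCommGroup E] [NormedSpace ℂ E] (p : Cn N) :
    HolGerm p →+* HolGerm ((p, 0) : Cn N × E) :=
  germPullback Prod.fst analyticAt_fst rfl

lemma IsKerChart.graphRestrict_germFst (hP : IsKerChart (F p) P) (hF : AnalyticAt ℂ F p)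
    (a : HolGerm p) : hP.graphRestrict hF (germFst (GrChart (matKer (F p))) p a) = a := by
  obtain ⟨f, hf, rfl⟩ := exists_germAt_eq a
  rw [germFst, germPullback_germAt _ _ hf,
    hP.graphRestrict_germAt hF (f := fun y => f y.1) (hf.fun_comp analyticAt_fst)]

lemma germFst_mem_tjurinaIdeal (hF : AnalyticAt ℂ F p)
    (K : Submodule ℂ (EuclideanSpace ℂ (Fin n))) {a : HolGerm p} (ha : a ∈ minorIdeal t F p) :
    germFst (GrChart K) p a ∈ tjurinaIdeal t F p K := by
  refine (Ideal.span_le (I := (tjurinaIdeal t F p K).comap (germFst (GrChart K) p))).2 ?_ ha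
  rintro _ ⟨R, C, rfl⟩
  rw [SetLike.mem_coe, Ideal.mem_comap, germFst, germPullback_germAt _ _ (analyticAt_minor hF R C)]
  exact Ideal.subset_span (Or.inl ⟨R, C, rfl⟩)

lemma IsKerChart.tjurinaIdeal_le_comap (hP : IsKerChart (F p) P) (hF : AnalyticAt ℂ F p)
    (hr : (Matrix.of (F p)).rank + 1 = t) :
    tjurinaIdeal t F p (matKer (F p)) ≤ (minorIdeal t F p).comap (hP.graphRestrict hF) := by
  have hFfst : AnalyticAt ℂ (fun y : Cn N × GrChart (matKer (F p)) => F y.1) (p, 0) :=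
    hF.fun_comp analyticAt_fst
  refine Ideal.span_le.2 ?_
  rintro _ (⟨R, C, rfl⟩ | ⟨f, hf, hfW, rfl⟩) <;> rw [SetLike.mem_coe, Ideal.mem_comap]
  · rw [hP.graphRestrict_germAt hF (analyticAt_minor hFfst R C)]
    exact Ideal.subset_span ⟨R, C, rfl⟩
  · rw [hP.graphRestrict_germAt hF
      (AnalyticAt.fun_comp (g := f) hf (hFfst.prod analyticAt_snd))]
    have hgraph : AnalyticAt ℂ (fun B => (B, P B)) (F p) := analyticAt_id.prod hP.analyticAt
    have hlim : Tendsto (fun B => (B, P B)) (𝓝 (F p)) (𝓝 (F p, 0)) := by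
      simpa only [hP.apply_self] using hgraph.continuousAt.tendsto
    refine germAt_comp_mem_minorIdeal (g := fun B => f (B, P B)) hF hr
      (AnalyticAt.fun_comp (g := f) (by rwa [hP.apply_self]) hgraph) ?_
    filter_upwards [hlim.eventually hfW, hP.eventually_mem_tjurinaW hr] with B hfB hB hrB
    exact hfB (hB hrB)

lemma IsKerChart.germAt_clm_snd_sub_mem (hP : IsKerChart (F p) P)
    (ℓ : GrChart (matKer (F p)) →L[ℂ] ℂ) :
    germAt (fun y : Cn N × GrChart (matKer (F p)) => ℓ (y.2 - P (F y.1))) (p, 0) ∈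
      tjurinaIdeal t F p (matKer (F p)) := by
  have hPfst : AnalyticAt ℂ (fun w : Mat m n × GrChart (matKer (F p)) => P w.1) (F p, 0) :=
    AnalyticAt.fun_comp (g := P) hP.analyticAt analyticAt_fst
  refine Ideal.subset_span (Or.inr ⟨fun w => ℓ (w.2 - P w.1), ?_, ?_, rfl⟩)
  · exact (ℓ.analyticAt _).fun_comp (analyticAt_snd.fun_sub hPfst)
  · filter_upwards [hP.eventually_snd_eq (t := t)] with w hw hwW
    rw [hw hwW, sub_self, map_zero]

lemma IsKerChart.sub_germFst_graphRestrict_mem (hP : IsKerChart (F p) P) (hF : AnalyticAt ℂ F p)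
    (a : HolGerm ((p, 0) : Cn N × GrChart (matKer (F p)))) :
    a - germFst (GrChart (matKer (F p))) p (hP.graphRestrict hF a) ∈
      tjurinaIdeal t F p (matKer (F p)) := by
  obtain ⟨f, hf, rfl⟩ := exists_germAt_eq a
  have hgraph : AnalyticAt ℂ (fun x => (x, P (F x))) p :=
    analyticAt_id.prod (hP.analyticAt.fun_comp hF)
  have hgraph_p : (p, P (F p)) = ((p, 0) : Cn N × GrChart (matKer (F p))) :=
    Prod.ext rfl hP.apply_self
  rw [hP.graphRestrict_germAt hF hf, germFst, germPullback_germAt _ _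
    (AnalyticAt.fun_comp (g := f) (hgraph_p ▸ hf) hgraph)]
  let e := Module.finBasis ℂ (Cn N × GrChart (matKer (F p)))
  have hsub (y : Cn N × GrChart (matKer (F p))) :
      y - (y.1, P (F y.1)) = (0, y.2 - P (F y.1)) := Prod.ext (sub_self _) rfl
  refine germAt_comp_sub_mem e hf (a := fun y => y) (b := fun y => (y.1, P (F y.1))) analyticAt_id
    (AnalyticAt.fun_comp (g := fun x => (x, P (F x))) hgraph analyticAt_fst) rfl hgraph_p
    fun i => ?_
  simp only [hsub]
  exact hP.germAt_clm_snd_sub_mem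
    ((e.coord i).toContinuousLinearMap ∘L ContinuousLinearMap.inr ℂ _ _)

theorem IsKerChart.tjurinaIdeal_eq_comap (hP : IsKerChart (F p) P) (hF : AnalyticAt ℂ F p)
    (hr : (Matrix.of (F p)).rank + 1 = t) :
    tjurinaIdeal t F p (matKer (F p)) = (minorIdeal t F p).comap (hP.graphRestrict hF) :=
  (hP.tjurinaIdeal_le_comap hF hr).antisymm fun a ha => by
    simpa using add_mem (hP.sub_germFst_graphRestrict_mem hF a)
      (germFst_mem_tjurinaIdeal hF (matKer (F p)) ha)

theorem nonempty_ringEquiv_tjurina (hF : AnalyticAt ℂ F p)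
    (hr : (Matrix.of (F p)).rank + 1 = t) :
    Nonempty (HolGerm ((p, 0) : Cn N × GrChart (matKer (F p))) ⧸
      tjurinaIdeal t F p (matKer (F p)) ≃+* detLocalRing t F p) := by
  obtain ⟨P, hP⟩ := exists_isKerChart (F p)
  let Φ := (Ideal.Quotient.mk (minorIdeal t F p)).comp (hP.graphRestrict hF)
  have hΦ : Function.Surjective Φ := Ideal.Quotient.mk_surjective.comp
    (Function.RightInverse.surjective (hP.graphRestrict_germFst hF))
  have hker : tjurinaIdeal t F p (matKer (F p)) = RingHom.ker Φ := by
    rw [hP.tjurinaIdeal_eq_comap hF hr, ← RingHom.comap_ker, Ideal.mk_ker]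
  exact ⟨(Ideal.quotEquivOfEq hker).trans (RingHom.quotientKerEquivOfSurjective hΦ)⟩

theorem isSingularAt_iff_isTjurinaSingularAt (hF : AnalyticAt ℂ F p)
    (hr : (Matrix.of (F p)).rank + 1 = t) {K : Submodule ℂ (EuclideanSpace ℂ (Fin n))}
    (hK : IsTjurinaPoint t F p K) : IsSingularAt t F p ↔ IsTjurinaSingularAt t F p K := by
  obtain rfl := (isTjurinaPoint_iff hr).1 hK
  obtain ⟨e⟩ := nonempty_ringEquiv_tjurina hF hr
  exact and_congr (iff_of_true hK.2.1 hK) (not_congr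
    ⟨fun _ => IsRegularLocalRing.of_ringEquiv e.symm, fun _ => IsRegularLocalRing.of_ringEquiv e⟩)

end TjurinaTransform

section Discriminant

variable {N m n t τ : ℕ} {𝓕 : Cn τ → Cn N → Mat m n} {U : Set (Cn N)} {S : Set (Cn τ)}

lemma contributionA_subset_discriminant
    (hlow : ∀ s ∈ S, ∀ x ∈ U, 𝓕 s x ∈ genericDet m n (t - 1) → IsSingularAt t (𝓕 s) x) :
    contributionA t 𝓕 U S ⊆ discriminant t 𝓕 U S := by
  rintro s ⟨hs, x, hx, hminors⟩
  exact ⟨hs, x, hx, hlow s hs x hx (rank_lt_iff_minors_eq_zero.2 hminors)⟩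

lemma contributionB'_subset_contributionB : contributionB' t 𝓕 U S ⊆ contributionB t 𝓕 U S :=
  fun _ ⟨hs, x, hx, _, h⟩ => ⟨hs, x, hx, h⟩

lemma contributionB_subset_discriminant : contributionB t 𝓕 U S ⊆ discriminant t 𝓕 U S :=
  fun _ ⟨hs, x, hx, hsing, _⟩ => ⟨hs, x, hx, hsing⟩

lemma discriminant_subset_union (han : ∀ s ∈ S, ∀ x ∈ U, AnalyticAt ℂ (𝓕 s) x) :
    discriminant t 𝓕 U S ⊆ contributionA t 𝓕 U S ∪ contributionB' t 𝓕 U S := by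
  rintro s ⟨hs, x, hx, hsing⟩
  have hlt : (Matrix.of (𝓕 s x)).rank < t := hsing.1
  by_cases hlow : (Matrix.of (𝓕 s x)).rank < t - 1
  · exact Or.inl ⟨hs, x, hx, rank_lt_iff_minors_eq_zero.1 hlow⟩
  · have hr : (Matrix.of (𝓕 s x)).rank + 1 = t := by omega
    obtain ⟨K, hK, -⟩ := existsUnique_isTjurinaPoint hr
    exact Or.inr ⟨hs, x, hx, hr, hsing, K,
      (isSingularAt_iff_isTjurinaSingularAt (han s hs x hx) hr hK).1 hsing⟩

theorem discriminant_eq_contributionA_union_contributionB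
    (han : ∀ s ∈ S, ∀ x ∈ U, AnalyticAt ℂ (𝓕 s) x)
    (hlow : ∀ s ∈ S, ∀ x ∈ U, 𝓕 s x ∈ genericDet m n (t - 1) → IsSingularAt t (𝓕 s) x) :
    discriminant t 𝓕 U S = contributionA t 𝓕 U S ∪ contributionB t 𝓕 U S :=
  ((discriminant_subset_union han).trans
    (Set.union_subset_union_right _ contributionB'_subset_contributionB)).antisymm
    (Set.union_subset (contributionA_subset_discriminant hlow) contributionB_subset_discriminant)

theorem discriminant_eq_contributionA_union_contributionB'
    (han : ∀ s ∈ S, ∀ x ∈ U, AnalyticAt ℂ (𝓕 s) x)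
    (hlow : ∀ s ∈ S, ∀ x ∈ U, 𝓕 s x ∈ genericDet m n (t - 1) → IsSingularAt t (𝓕 s) x) :
    discriminant t 𝓕 U S = contributionA t 𝓕 U S ∪ contributionB' t 𝓕 U S :=
  (discriminant_subset_union han).antisymm (Set.union_subset
    (contributionA_subset_discriminant hlow)
    (contributionB'_subset_contributionB.trans contributionB_subset_discriminant))

end Discriminant

end DetSing

end

theorem mainTheorem3_general {N m n t τ : ℕ}
    (𝓕 : DetSing.Cn τ → DetSing.Cn N → DetSing.Mat m n)
    (h𝓕 : AnalyticAt ℂ (fun y : DetSing.Cn τ × DetSing.Cn N => 𝓕 y.1 y.2) (0, 0))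
    (hne : DetSing.minorIdeal t (𝓕 0) 0 ≠ ⊥) :
    ∃ U₀ ∈ 𝓝 (0 : DetSing.Cn N), ∃ S₀ ∈ 𝓝 (0 : DetSing.Cn τ),
      (∀ U ⊆ U₀, ∀ S ⊆ S₀,
        DetSing.discriminant t 𝓕 U S =
            DetSing.contributionA t 𝓕 U S ∪ DetSing.contributionB t 𝓕 U S ∧
        DetSing.discriminant t 𝓕 U S =
            DetSing.contributionA t 𝓕 U S ∪ DetSing.contributionB' t 𝓕 U S) ∧
      (∀ s ∈ S₀, ∀ x ∈ U₀,
        (𝓕 s x ∈ DetSing.genericDet m n (t - 1) → DetSing.IsSingularAt t (𝓕 s) x) ∧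
        ((Matrix.of (𝓕 s x)).rank + 1 = t →
          (∃! K, DetSing.IsTjurinaPoint t (𝓕 s) x K) ∧
          ∀ K, DetSing.IsTjurinaPoint t (𝓕 s) x K →
            (DetSing.IsSingularAt t (𝓕 s) x ↔ DetSing.IsTjurinaSingularAt t (𝓕 s) x K))) := by
  obtain ⟨S₀, hS₀, U₀, hU₀, hSU⟩ := mem_nhds_prod_iff.1
    (h𝓕.eventually_analyticAt.and (DetSing.eventually_minorIdeal_ne_bot h𝓕 hne))
  have han : ∀ s ∈ S₀, ∀ x ∈ U₀, AnalyticAt ℂ (𝓕 s) x := fun s hs x hx =>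
    (hSU (Set.mk_mem_prod hs hx)).1.curry_right
  have hlow : ∀ s ∈ S₀, ∀ x ∈ U₀,
      𝓕 s x ∈ DetSing.genericDet m n (t - 1) → DetSing.IsSingularAt t (𝓕 s) x :=
    fun s hs x hx => DetSing.isSingularAt_of_mem_genericDet (han s hs x hx)
      (hSU (Set.mk_mem_prod hs hx)).2
  refine ⟨U₀, hU₀, S₀, hS₀, fun U hU S hS => ?_, fun s hs x hx => ⟨hlow s hs x hx, fun hr => ?_⟩⟩
  · have han' : ∀ s ∈ S, ∀ x ∈ U, AnalyticAt ℂ (𝓕 s) x := fun s hs x hx =>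
      han s (hS hs) x (hU hx)
    have hlow' : ∀ s ∈ S, ∀ x ∈ U,
        𝓕 s x ∈ DetSing.genericDet m n (t - 1) → DetSing.IsSingularAt t (𝓕 s) x :=
      fun s hs x hx => hlow s (hS hs) x (hU hx)
    exact ⟨DetSing.discriminant_eq_contributionA_union_contributionB han' hlow',
      DetSing.discriminant_eq_contributionA_union_contributionB' han' hlow'⟩
  · exact ⟨DetSing.existsUnique_isTjurinaPoint hr, fun K hK =>
      DetSing.isSingularAt_iff_isTjurinaSingularAt (han s hs x hx) hr hK⟩

theorem mainTheorem3 {N m n t τ : ℕ}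
    (F : DetSing.Cn N → DetSing.Mat m n) (G : Fin τ → DetSing.Cn N → DetSing.Mat m n)
    (hX : DetSing.IsDeterminantal t F)
    (hdim : (m : WithBot ℕ∞) ≤ ringKrullDim (DetSing.detLocalRing t F 0))
    (hG : DetSing.IsGVersalBasis F G) :
    ∃ U₀ ∈ 𝓝 (0 : DetSing.Cn N), ∃ S₀ ∈ 𝓝 (0 : DetSing.Cn τ),
      -- the discriminant is the union of the two contributions, for every smaller representative
      (∀ U ⊆ U₀, ∀ S ⊆ S₀,
        DetSing.discriminant t (DetSing.versalFamily F G) U S =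
            DetSing.contributionA t (DetSing.versalFamily F G) U S ∪
              DetSing.contributionB t (DetSing.versalFamily F G) U S ∧
        DetSing.discriminant t (DetSing.versalFamily F G) U S =
            DetSing.contributionA t (DetSing.versalFamily F G) U S ∪
              DetSing.contributionB' t (DetSing.versalFamily F G) U S) ∧
      -- the decomposition comes from one of the singular points of the fibres
      (∀ s ∈ S₀, ∀ x ∈ U₀,
        (DetSing.versalFamily F G s x ∈ DetSing.genericDet m n (t - 1) →
          DetSing.IsSingularAt t (DetSing.versalFamily F G s) x) ∧
        ((Matrix.of (DetSing.versalFamily F G s x)).rank + 1 = t →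
          (∃! K, DetSing.IsTjurinaPoint t (DetSing.versalFamily F G s) x K) ∧
          ∀ K, DetSing.IsTjurinaPoint t (DetSing.versalFamily F G s) x K →
            (DetSing.IsSingularAt t (DetSing.versalFamily F G s) x ↔
              DetSing.IsTjurinaSingularAt t (DetSing.versalFamily F G s) x K))) :=
  mainTheorem3_general (DetSing.versalFamily F G)
    (DetSing.analyticAt_versalFamily hX.analytic hG.analytic)
    (by rw [DetSing.versalFamily_zero]; exact hX.minorIdeal_ne_bot)
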